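/- **Setting.** Let $M$ subsystems be coupled through a directed graph, where an edge $(j,i)$ means that $j$ influences $i$. Let $\mathcal N_i$ consist of $i$ and all $j$ that influence $i$, and let $\{i,j\}$, $i\ne j$, be an edge of the undirected communication graph if one of $i,j$ influences the other. Let $T_i,W_i$ be the $0/1$ matrices with $x_i=T_ix$, $x_{\mathcal N_i}=W_ix$. Known are matrices $A'_{\mathcal N_i},B'_i,B_{d,i},B_{w,i},C_{y,\mathcal N_i},D_{y,i},C_{z,\mathcal N_i},D_{z,i}$ of the model $x_i^+=A'_{\mathcal N_i}x_{\mathcal N_i}+B'_iu_i+B_{d,i}d_i+B_{w,i}w_i$, $y_i=C_{y,\mathcal N_i}x_{\mathcal N_i}+D_{y,i}u_i$, $z_i=C_{z,\mathcal N_i}x_{\mathcal N_i}+D_{z,i}u_i$, $w_i=\Delta_iz_i$ with $\Delta_i$ unknown; data matrices $U_i=[u_i^0\cdots u_i^{N-1}]$, $X_i^+=[x_i^1\cdots x_i^N]$, $X_{\mathcal N_i}=[x_{\mathcal N_i}^0\cdots x_{\mathcal N_i}^{N-1}]$; matrices $Q_{d,i},S_{d,i},R_{d,i}$ and numbers $\overline\delta_i$.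 With $Z_i=C_{z,\mathcal N_i}X_{\mathcal N_i}+D_{z,i}U_i$ and $M_i=X_i^+-A'_{\mathcal N_i}X_{\mathcal N_i}-B'_iU_i$, let $\overline{\mathbf P}_{\mathrm{com},i}$ be the set of the matrices $$\begin{bmatrix}0&I\\I&0\end{bmatrix}^{\top}\left(\tau\begin{bmatrix}-Z_i&0\\M_i&B_{d,i}\end{bmatrix}\begin{bmatrix}Q_{d,i}&S_{d,i}\\S_{d,i}^\top&R_{d,i}\end{bmatrix}\begin{bmatrix}-Z_i&0\\M_i&B_{d,i}\end{bmatrix}^\top+\lambda\begin{bmatrix}-I&0\\0&\overline\delta_iB_{w,i}B_{w,i}^\top\end{bmatrix}\right)\begin{bmatrix}0&I\\I&0\end{bmatrix},\qquad \tau>0,\ \lambda\ge0 .$$ **Matrix inequalities.** In variables $\Phi_i,E_i,P_i\in\overline{\mathbf P}_{\mathrm{com},i}$, $S_{\mathcal N_i}$ (symmetric, block-diagonal), $F_{\mathcal N_i}$, $Y_{\mathcal N_i}$, with $E_{\mathcal N_i}=\mathrm{diag}(E_j)_{j\in\mathcal N_i}$ and $\overline E_i=W_iT_i^\top E_iT_iW_i^\top$,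 they read, for each $i$: $E_i\succ0$, $E_{\mathcal N_i}\succ0$, $\Phi_i\succ0$, $$\begin{bmatrix}\Phi_i&B_{d,i}^\top\\ B_{d,i}&E_i\end{bmatrix}\succ0,\qquad \begin{bmatrix}P_i+\begin{bmatrix}-E_i&0\\0&0\end{bmatrix}&*&*\\ \begin{bmatrix}A'_{\mathcal N_i}E_{\mathcal N_i}+B'_iY_{\mathcal N_i}\\ C_{z,\mathcal N_i}E_{\mathcal N_i}+D_{z,i}Y_{\mathcal N_i}\end{bmatrix}^\top&-\overline E_i-F_{\mathcal N_i}&*\\0&C_{y,\mathcal N_i}E_{\mathcal N_i}+D_{y,i}Y_{\mathcal N_i}&-I\end{bmatrix}\prec0,$$ $$F_{\mathcal N_i}\preceq S_{\mathcal N_i},\qquad \sum_{j\in\mathcal N_i}T_iW_j^\top S_{\mathcal N_j}W_jT_i^\top\preceq0 .$$ For $\varepsilon\ge0$, the *$\varepsilon$-inequalities* are obtained by replacing each strict inequality $X\succ0$ by $X\succeq\varepsilon I$ (thus $X\prec 0$ by $-X\succeq\varepsilon I$) and $\tau>0$ by $\tau\ge\varepsilon$. The *global $\varepsilon$-problem*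 is to minimize $\sum_i\mathrm{trace}(\Phi_i)$ subject to the $\varepsilon$-inequalities for all $i$; let $\mathrm{Sol}_\varepsilon$ be its set of solutions. **Iteration.** Agent $i$ holds $\Xi_i=(\Phi_i,(E^{(i)}_j)_j,P_i,(S^{(i)}_{\mathcal N_j})_j,F_{\mathcal N_i},Y_{\mathcal N_i})$, where $j$ runs through $i$ and its neighbours in the communication graph. $\mathcal C_i$ is the set of those $\Xi_i$ which satisfy the $\varepsilon$-inequalities of agent $i$ with $E_j,S_{\mathcal N_j}$ replaced by $E_j^{(i)},S_{\mathcal N_j}^{(i)}$, and in which all held copies satisfy $E_j^{(i)}\succeq\varepsilon I$ and $S^{(i)}_{\mathcal N_j}$ symmetric and block-diagonal. For an edge $e=\{i,j\}$ let $h_e(\Xi_q)$, $q\in e$, be the vector of the entries of $E_i^{(q)},E_j^{(q)},S_{\mathcal N_i}^{(q)},S_{\mathcal N_j}^{(q)}$. Given $\alpha>0$ and arbitrary $\nu_e^0,\mu^0_{e,q}$, the edge-based ADMM iteration is $$\Xi_i^{t+1}\in\operatorname*{argmin}_{\Xi_i\in\mathcal C_i}\ \mathrm{trace}(\Phi_i)+\sum_{e\ni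 i}\Big(\mu_{e,i}^{t\,\top}(h_e(\Xi_i)-\nu_e^t)+\tfrac\alpha2\|h_e(\Xi_i)-\nu_e^t\|_2^2\Big),$$ $$\nu_e^{t+1}=\operatorname*{argmin}_{\nu}\sum_{q\in e}\Big(\mu_{e,q}^{t\,\top}(h_e(\Xi_q^{t+1})-\nu)+\tfrac\alpha2\|h_e(\Xi_q^{t+1})-\nu\|_2^2\Big),\qquad \mu_{e,q}^{t+1}=\mu_{e,q}^t+\alpha\big(h_e(\Xi_q^{t+1})-\nu_e^{t+1}\big).$$ **Theorem (ADMM convergence).** Suppose that the (strict) matrix inequalities have a solution, and let $v$ be the infimum of $\sum_i\mathrm{trace}(\Phi_i)$ over all their solutions. For every $\eta>0$ there is $\varepsilon_0>0$ such that for all $0\le\varepsilon<\varepsilon_0$ for which the global $\varepsilon$-problem has a solution, and for all $\alpha>0$: 1. If $\mathrm{Sol}_\varepsilon$ is compact, then for all $\nu^0,\mu^0$ there is a sequence $(\Xi^t,\nu^t,\mu^t)$ generated by the iteration. For every sequence generated by the iteration: 2. $\sum_i\mathrm{trace}(\Phi_i^t)$ converges to the minimum $c$ of the global $\varepsilon$-problem,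 and $v\le c\le v+\eta$ (so $c=v$ for $\varepsilon=0$). 3. For every edge $e=\{i,j\}$ the vectors $\nu_e^t$, $h_e(\Xi_i^t)$ and $h_e(\Xi_j^t)$ converge to one common limit. If $\mathrm{Sol}_\varepsilon$ is compact, there is one element of $\mathrm{Sol}_\varepsilon$ whose variables $E_i,E_j,S_{\mathcal N_i},S_{\mathcal N_j}$ are these limits, for all edges. 4. If $\mathrm{Sol}_\varepsilon$ is compact, the owners' variables $(\Phi_i^t,E_i^{(i),t},P_i^t,S_{\mathcal N_i}^{(i),t},F_{\mathcal N_i}^t,Y_{\mathcal N_i}^t)_i$ converge to $\mathrm{Sol}_\varepsilon$, that is, they eventually lie in each neighbourhood of $\mathrm{Sol}_\varepsilon$; in particular they converge to the solution if it is unique. 5. Every cluster point of $(\Xi^t)$ (in particular its limit, if it converges) satisfies $E_i^{(j)}=E_i^{(i)}$ and $S_{\mathcal N_i}^{(j)}=S_{\mathcal N_i}^{(i)}$ whenever agent $j$ holds copies of $i$'s variables; its owners' variables belong to $\mathrm{Sol}_\varepsilon$; and if $\varepsilon>0$, they satisfy the strict matrix inequalities for all $i$, together with $\mathrm{trace}(\Phi_i)<\gamma_i^2$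 for all $\gamma_i>0$ with $\gamma_i^2>\mathrm{trace}(\Phi_i)$. -/

import Mathlib

open Matrix Filter Topology

noncomputable section

namespace GrayBoxADMM

/-! ### The network -/

/-- Directed physical coupling graph on the subsystems `0, …, M - 1` together with the state
dimensions. `G.Adj j i` means that the state of `j` directly influences subsystem `i`. -/
structure Network (M : ℕ) where
  G : Digraph (Fin M)
  n : Fin M → ℕ

namespace Network

variable {M : ℕ} (w : Network M)

open Classical in
/-- The neighbourhood `N_i`: the subsystems that influence `i`, and `i` itself. -/
def nbhd (i : Fin M) : Finset (Fin M) := Finset.univ.filter fun j => w.G.Adj j i ∨ j = i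

lemma self_mem_nbhd (i : Fin M) : i ∈ w.nbhd i := by simp [nbhd]

/-- The undirected communication graph: `i ≠ j` are joined if one of them influences the other. -/
def comm : SimpleGraph (Fin M) := SimpleGraph.fromRel w.G.Adj

open Classical in
/-- The agents of which `i` holds a copy: `i` itself and its neighbours in the communication
graph. This is `N_i` when the physical coupling is bidirectional. -/
def cnbhd (i : Fin M) : Finset (Fin M) := Finset.univ.filter fun j => w.comm.Adj i j ∨ j = i

lemma self_mem_cnbhd (i : Fin M) : i ∈ w.cnbhd i := by simp [cnbhd]

lemma nbhd_subset_cnbhd (i : Fin M) : w.nbhd i ⊆ w.cnbhd i := by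
  intro j hj
  simp only [nbhd, Finset.mem_filter, Finset.mem_univ, true_and] at hj
  simp only [cnbhd, Finset.mem_filter, Finset.mem_univ, true_and]
  by_cases h : j = i
  · exact Or.inr h
  · refine Or.inl ?_
    rw [comm, SimpleGraph.fromRel_adj]
    exact ⟨fun e => h e.symm, Or.inr (hj.resolve_right h)⟩

/-- Index of an entry of the state `x_i`. -/
abbrev Idx (i : Fin M) : Type := Fin (w.n i)

/-- Index of an entry of the stacked neighbourhood state `x_{N_i}`. -/
abbrev NIdx (i : Fin M) : Type := Σ j : {j // j ∈ w.nbhd i}, w.Idx j.1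

/-- Index of an entry of the global state `x`. -/
abbrev GIdx : Type := Σ i : Fin M, w.Idx i

/-- The lifting matrix `T_i` with `x_i = T_i x`. -/
def T (i : Fin M) : Matrix (w.Idx i) w.GIdx ℝ :=
  Matrix.of fun a b => if b = ⟨i, a⟩ then 1 else 0

/-- The lifting matrix `W_i` with `x_{N_i} = W_i x`. -/
def W (i : Fin M) : Matrix (w.NIdx i) w.GIdx ℝ :=
  Matrix.of fun a b => if b = ⟨a.1.1, a.2⟩ then 1 else 0

/-- A matrix on the stacked neighbourhood state which is block-diagonal with respect to the
subsystems of the neighbourhood. -/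
def IsBlockDiag (i : Fin M) (S : Matrix (w.NIdx i) (w.NIdx i) ℝ) : Prop :=
  ∀ a b, a.1 ≠ b.1 → S a b = 0

/-- `E_{N_i} = diag(E_j)_{j ∈ N_i}`. -/
def EN (i : Fin M) (E : ∀ j : {j // j ∈ w.nbhd i}, Matrix (w.Idx j.1) (w.Idx j.1) ℝ) :
    Matrix (w.NIdx i) (w.NIdx i) ℝ :=
  Matrix.blockDiagonal' E

/-- `W_i T_iᵀ E_i T_i W_iᵀ`. -/
def Ebar (i : Fin M) (Ei : Matrix (w.Idx i) (w.Idx i) ℝ) : Matrix (w.NIdx i) (w.NIdx i) ℝ :=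
  w.W i * (w.T i)ᵀ * Ei * w.T i * (w.W i)ᵀ

/-- `∑_{j ∈ N_i} T_i W_jᵀ S_{N_j} W_j T_iᵀ`. -/
def coupling (i : Fin M) (S : ∀ j : {j // j ∈ w.nbhd i}, Matrix (w.NIdx j.1) (w.NIdx j.1) ℝ) :
    Matrix (w.Idx i) (w.Idx i) ℝ :=
  ∑ j : {j // j ∈ w.nbhd i}, w.T i * (w.W j.1)ᵀ * S j * w.W j.1 * (w.T i)ᵀ

/-! ### Edges of the communication graph -/

/-- The edges `{i, j}` of the communication graph. -/
abbrev Edge : Type := {e : Sym2 (Fin M) // e ∈ w.comm.edgeSet}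

/-- The two end points of an edge. -/
def Endpt (e : w.Edge) : Type := {q : Fin M // q ∈ e.1}

instance (e : w.Edge) : Fintype (w.Endpt e) := by
  classical exact inferInstanceAs (Fintype {q : Fin M // q ∈ e.1})

/-- The edges of the communication graph at agent `i`. -/
def Inc (i : Fin M) : Type := {e : w.Edge // i ∈ e.1}

instance (i : Fin M) : Fintype (w.Inc i) := by
  classical exact inferInstanceAs (Fintype {e : w.Edge // i ∈ e.1})

/-- Index of an entry of the stacked vector of `vect(E_q)`, `vect(S_{N_q})`, `q` running through
the two end points of `e`. -/
abbrev EdgeIdx (e : w.Edge) : Type :=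
  Σ q : w.Endpt e, (w.Idx q.1 × w.Idx q.1) ⊕ (w.NIdx q.1 × w.NIdx q.1)

/-- The space of the edge variables, with its Euclidean norm and inner product. -/
abbrev EdgeVec (e : w.Edge) : Type := EuclideanSpace ℝ (w.EdgeIdx e)

/-- Stack `vect(E_q)`, `vect(S_{N_q})` over the two end points `q` of the edge `e`. -/
def stack (e : w.Edge) (E : ∀ q : w.Endpt e, Matrix (w.Idx q.1) (w.Idx q.1) ℝ)
    (S : ∀ q : w.Endpt e, Matrix (w.NIdx q.1) (w.NIdx q.1) ℝ) : w.EdgeVec e :=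
  WithLp.toLp 2 fun k => match k with
    | ⟨q, Sum.inl ab⟩ => E q ab.1 ab.2
    | ⟨q, Sum.inr ab⟩ => S q ab.1 ab.2

lemma mem_cnbhd_of_endpt {i : Fin M} (e : w.Inc i) (q : w.Endpt e.1) : q.1 ∈ w.cnbhd i := by
  obtain ⟨⟨e, he⟩, hi⟩ := e
  obtain ⟨q, hq⟩ := q
  simp only [cnbhd, Finset.mem_filter, Finset.mem_univ, true_and]
  by_cases h : q = i
  · exact Or.inr h
  · refine Or.inl ?_
    have hs : e = s(i, q) := (Sym2.mem_and_mem_iff (fun hh => h hh.symm)).1 ⟨hi, hq⟩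
    rw [hs] at he
    simpa using he

end Network

/-! ### Gray-box data and multipliers -/

/-- What the agents know: the network, the known matrices of
`x_i⁺ = A' x_{N_i} + B' u_i + B_d d_i + B_w w_i`, `y_i = C_y x_{N_i} + D_y u_i`,
`z_i = C_z x_{N_i} + D_z u_i`, `w_i = Δ_i z_i` (`Δ_i` unknown), an input-state data set of length
`N`, the blocks `Q_d, S_d, R_d` of the quadratic disturbance bound, and the bound `δ` in
`Δ_i Δ_iᵀ ⪯ δ_i I`. -/
structure GrayBox (M N : ℕ) extends Network M where
  m : Fin M → ℕ
  nd : Fin M → ℕ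
  nw : Fin M → ℕ
  nz : Fin M → ℕ
  p : Fin M → ℕ
  A' : ∀ i, Matrix (toNetwork.Idx i) (toNetwork.NIdx i) ℝ
  B' : ∀ i, Matrix (toNetwork.Idx i) (Fin (m i)) ℝ
  Bd : ∀ i, Matrix (toNetwork.Idx i) (Fin (nd i)) ℝ
  Bw : ∀ i, Matrix (toNetwork.Idx i) (Fin (nw i)) ℝ
  Cy : ∀ i, Matrix (Fin (p i)) (toNetwork.NIdx i) ℝ
  Dy : ∀ i, Matrix (Fin (p i)) (Fin (m i)) ℝ
  Cz : ∀ i, Matrix (Fin (nz i)) (toNetwork.NIdx i) ℝ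
  Dz : ∀ i, Matrix (Fin (nz i)) (Fin (m i)) ℝ
  u : ∀ i, Fin N → Fin (m i) → ℝ
  x : ∀ i, Fin (N + 1) → toNetwork.Idx i → ℝ
  Qd : ∀ _ : Fin M, Matrix (Fin N) (Fin N) ℝ
  Sd : ∀ i, Matrix (Fin N) (Fin (nd i)) ℝ
  Rd : ∀ i, Matrix (Fin (nd i)) (Fin (nd i)) ℝ
  δ : Fin M → ℝ

namespace GrayBox

variable {M N : ℕ} (d : GrayBox M N)

/-- Data matrix `U_i = [u_i^0 … u_i^{N-1}]`. -/
def dataU (i : Fin M) : Matrix (Fin (d.m i)) (Fin N) ℝ := Matrix.of fun a k => d.u i k a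

/-- Data matrix `X_i⁺ = [x_i^1 … x_i^N]`. -/
def dataXplus (i : Fin M) : Matrix (d.Idx i) (Fin N) ℝ := Matrix.of fun a k => d.x i k.succ a

/-- Data matrix `X_{N_i} = [x_{N_i}^0 … x_{N_i}^{N-1}]`. -/
def dataX (i : Fin M) : Matrix (d.NIdx i) (Fin N) ℝ :=
  Matrix.of fun a k => d.x a.1.1 k.castSucc a.2

/-- `Z_i = C_z X_{N_i} + D_z U_i`. -/
def dataZ (i : Fin M) : Matrix (Fin (d.nz i)) (Fin N) ℝ := d.Cz i * d.dataX i + d.Dz i * d.dataU i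

/-- `M_i = X_i⁺ - A' X_{N_i} - B' U_i`. -/
def dataM (i : Fin M) : Matrix (d.Idx i) (Fin N) ℝ :=
  d.dataXplus i - d.A' i * d.dataX i - d.B' i * d.dataU i

/-- The disturbance multipliers `τ [Q_d S_d; S_dᵀ R_d]`, `τ` in the given range. -/
def multD (i : Fin M) (range : Set ℝ) : Set (Matrix (Fin N ⊕ Fin (d.nd i)) (Fin N ⊕ Fin (d.nd i)) ℝ) :=
  {P | ∃ τ ∈ range, P = τ • fromBlocks (d.Qd i) (d.Sd i) (d.Sd i)ᵀ (d.Rd i)}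

/-- The data-driven multipliers `[-Z 0; M B_d] P_d [-Z 0; M B_d]ᵀ`. -/
def multData (i : Fin M) (range : Set ℝ) :
    Set (Matrix (Fin (d.nz i) ⊕ d.Idx i) (Fin (d.nz i) ⊕ d.Idx i) ℝ) :=
  {P | ∃ Pd ∈ d.multD i range, P = fromBlocks (-d.dataZ i) 0 (d.dataM i) (d.Bd i) * Pd *
    (fromBlocks (-d.dataZ i) 0 (d.dataM i) (d.Bd i))ᵀ}

/-- `[I 0; 0 B_w]`. -/
def priorFactor (i : Fin M) :
    Matrix (Fin (d.nz i) ⊕ d.Idx i) (Fin (d.nz i) ⊕ Fin (d.nw i)) ℝ :=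
  fromBlocks 1 0 0 (d.Bw i)

/-- `[-I 0; 0 δ I]`. -/
def priorCore (i : Fin M) :
    Matrix (Fin (d.nz i) ⊕ Fin (d.nw i)) (Fin (d.nz i) ⊕ Fin (d.nw i)) ℝ :=
  fromBlocks (-1) 0 0 (d.δ i • 1)

/-- The prior-knowledge multipliers `lam [I 0; 0 B_w] [-I 0; 0 δ I] [I 0; 0 B_wᵀ]`, `lam ≥ 0`. -/
def multPrior (i : Fin M) :
    Set (Matrix (Fin (d.nz i) ⊕ d.Idx i) (Fin (d.nz i) ⊕ d.Idx i) ℝ) :=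
  {P | ∃ lam : ℝ, 0 ≤ lam ∧ P = lam • (d.priorFactor i * d.priorCore i * (d.priorFactor i)ᵀ)}

/-- `[0 I; I 0]`. -/
def mirror (i : Fin M) : Matrix (Fin (d.nz i) ⊕ d.Idx i) (d.Idx i ⊕ Fin (d.nz i)) ℝ :=
  fromBlocks 0 1 1 0

/-- The mirrored combined multipliers `[0 I; I 0]ᵀ (P_data + P_prior) [0 I; I 0]`, where the scaling
`τ` of the data-driven part lies in the given range. -/
def multCom (i : Fin M) (range : Set ℝ) :
    Set (Matrix (d.Idx i ⊕ Fin (d.nz i)) (d.Idx i ⊕ Fin (d.nz i)) ℝ) :=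
  {P | ∃ P₁ ∈ d.multData i range, ∃ P₂ ∈ d.multPrior i,
    P = (d.mirror i)ᵀ * (P₁ + P₂) * d.mirror i}

/-! ### The matrix inequalities -/

/-- `[Φ_i B_dᵀ; B_d E_i]`. -/
def perfMatrix (i : Fin M) (Φ : Matrix (Fin (d.nd i)) (Fin (d.nd i)) ℝ)
    (Ei : Matrix (d.Idx i) (d.Idx i) ℝ) :
    Matrix (Fin (d.nd i) ⊕ d.Idx i) (Fin (d.nd i) ⊕ d.Idx i) ℝ :=
  fromBlocks Φ (d.Bd i)ᵀ (d.Bd i) Ei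

/-- The symmetric matrix with lower-left part
`P_com + [-E_i 0; 0 0]`; `[A' E_{N_i} + B' Y; C_z E_{N_i} + D_z Y]ᵀ`, `-Ē_i - F`;
`0`, `C_y E_{N_i} + D_y Y`, `-I`. -/
def stabMatrix (i : Fin M) (E : ∀ j : {j // j ∈ d.nbhd i}, Matrix (d.Idx j.1) (d.Idx j.1) ℝ)
    (P : Matrix (d.Idx i ⊕ Fin (d.nz i)) (d.Idx i ⊕ Fin (d.nz i)) ℝ)
    (F : Matrix (d.NIdx i) (d.NIdx i) ℝ) (Y : Matrix (Fin (d.m i)) (d.NIdx i) ℝ) :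
    Matrix ((d.Idx i ⊕ Fin (d.nz i)) ⊕ d.NIdx i ⊕ Fin (d.p i))
      ((d.Idx i ⊕ Fin (d.nz i)) ⊕ d.NIdx i ⊕ Fin (d.p i)) ℝ :=
  let Ei := E ⟨i, d.self_mem_nbhd i⟩
  let L : Matrix (d.Idx i ⊕ Fin (d.nz i)) (d.NIdx i) ℝ :=
    fromRows (d.A' i * d.EN i E + d.B' i * Y) (d.Cz i * d.EN i E + d.Dz i * Y)
  let K : Matrix (Fin (d.p i)) (d.NIdx i) ℝ := d.Cy i * d.EN i E + d.Dy i * Y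
  fromBlocks (P + fromBlocks (-Ei) 0 0 0) (fromCols L 0) (fromRows Lᵀ 0)
    (fromBlocks (-d.Ebar i Ei - F) Kᵀ K (-1))

/-- The matrix inequalities of agent `i`, with every strict inequality read literally. `E j` and
`S j` stand for `E_j` and `S_{N_j}`, `j ∈ N_i`. -/
structure StrictLMI (i : Fin M) (Φ : Matrix (Fin (d.nd i)) (Fin (d.nd i)) ℝ)
    (E : ∀ j : {j // j ∈ d.nbhd i}, Matrix (d.Idx j.1) (d.Idx j.1) ℝ)
    (P : Matrix (d.Idx i ⊕ Fin (d.nz i)) (d.Idx i ⊕ Fin (d.nz i)) ℝ)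
    (S : ∀ j : {j // j ∈ d.nbhd i}, Matrix (d.NIdx j.1) (d.NIdx j.1) ℝ)
    (F : Matrix (d.NIdx i) (d.NIdx i) ℝ) (Y : Matrix (Fin (d.m i)) (d.NIdx i) ℝ) : Prop where
  E_pos : (E ⟨i, d.self_mem_nbhd i⟩).PosDef
  EN_pos : (d.EN i E).PosDef
  Φ_pos : Φ.PosDef
  P_mem : P ∈ d.multCom i (Set.Ioi 0)
  S_block : ∀ j, (S j).IsSymm ∧ d.IsBlockDiag j.1 (S j)
  perf : (d.perfMatrix i Φ (E ⟨i, d.self_mem_nbhd i⟩)).PosDef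
  stab : (-d.stabMatrix i E P F Y).PosDef
  F_le_S : (S ⟨i, d.self_mem_nbhd i⟩ - F).PosSemidef
  coupling : (-d.coupling i S).PosSemidef

/-- The same matrix inequalities with every strict inequality `X ≻ 0` replaced by the closed
condition `X ⪰ ε I` (and `τ > 0` by `τ ≥ ε`). For `ε > 0` this is the usual numerical margin; for
`ε = 0` these are the non-strict inequalities. -/
structure MarginLMI (ε : ℝ) (i : Fin M) (Φ : Matrix (Fin (d.nd i)) (Fin (d.nd i)) ℝ)
    (E : ∀ j : {j // j ∈ d.nbhd i}, Matrix (d.Idx j.1) (d.Idx j.1) ℝ)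
    (P : Matrix (d.Idx i ⊕ Fin (d.nz i)) (d.Idx i ⊕ Fin (d.nz i)) ℝ)
    (S : ∀ j : {j // j ∈ d.nbhd i}, Matrix (d.NIdx j.1) (d.NIdx j.1) ℝ)
    (F : Matrix (d.NIdx i) (d.NIdx i) ℝ) (Y : Matrix (Fin (d.m i)) (d.NIdx i) ℝ) : Prop where
  E_pos : (E ⟨i, d.self_mem_nbhd i⟩ - ε • 1).PosSemidef
  EN_pos : (d.EN i E - ε • 1).PosSemidef
  Φ_pos : (Φ - ε • 1).PosSemidef
  P_mem : P ∈ d.multCom i (Set.Ici ε)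
  S_block : ∀ j, (S j).IsSymm ∧ d.IsBlockDiag j.1 (S j)
  perf : (d.perfMatrix i Φ (E ⟨i, d.self_mem_nbhd i⟩) - ε • 1).PosSemidef
  stab : (-d.stabMatrix i E P F Y - ε • 1).PosSemidef
  F_le_S : (S ⟨i, d.self_mem_nbhd i⟩ - F).PosSemidef
  coupling : (-d.coupling i S).PosSemidef

/-! ### The global problem -/

/-- The variables `(Φ_i, E_i, P_com,i, S_{N_i}, F_{N_i}, Y_{N_i})` owned by agent `i`. -/
abbrev OwnVars (i : Fin M) : Type :=
  Matrix (Fin (d.nd i)) (Fin (d.nd i)) ℝ ×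
  Matrix (d.Idx i) (d.Idx i) ℝ ×
  Matrix (d.Idx i ⊕ Fin (d.nz i)) (d.Idx i ⊕ Fin (d.nz i)) ℝ ×
  Matrix (d.NIdx i) (d.NIdx i) ℝ ×
  Matrix (d.NIdx i) (d.NIdx i) ℝ ×
  Matrix (Fin (d.m i)) (d.NIdx i) ℝ

namespace OwnVars

variable {d} {i : Fin M} (X : d.OwnVars i)

abbrev Φ := X.1
abbrev E := X.2.1
abbrev P := X.2.2.1
abbrev S := X.2.2.2.1
abbrev F := X.2.2.2.2.1
abbrev Y := X.2.2.2.2.2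

end OwnVars

/-- The variables of the global problem. -/
abbrev GlobalVars : Type := ∀ i : Fin M, d.OwnVars i

/-- The objective `∑_i trace(Φ_i)`. -/
def cost (X : d.GlobalVars) : ℝ := ∑ i, (X i).Φ.trace

/-- The matrix inequalities, read strictly, hold for all agents. -/
def strictFeasible : Set d.GlobalVars :=
  {X | ∀ i, d.StrictLMI i (X i).Φ (fun j => (X j.1).E) (X i).P (fun j => (X j.1).S)
    (X i).F (X i).Y}

/-- The matrix inequalities hold with margin `ε` for all agents. -/
def feasible (ε : ℝ) : Set d.GlobalVars :=
  {X | ∀ i, d.MarginLMI ε i (X i).Φ (fun j => (X j.1).E) (X i).P (fun j => (X j.1).S)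
    (X i).F (X i).Y}

/-- The solutions of the global problem: minimize `∑_i trace(Φ_i)` over the feasible set. -/
def solutions (ε : ℝ) : Set d.GlobalVars :=
  {X | X ∈ d.feasible ε ∧ IsMinOn d.cost (d.feasible ε) X}

/-- The synthesis inequalities, including the performance bounds `trace(Φ_i) < γ_i²`. -/
def SynthesisLMIs (γ : Fin M → ℝ) (X : d.GlobalVars) : Prop :=
  (∀ i, 0 < γ i ∧ (X i).Φ.trace < γ i ^ 2) ∧ X ∈ d.strictFeasible

/-! ### Local copies and the ADMM iteration -/

/-- The variables `Ξ_i` of agent `i`: `Φ_i`, the copies `E_j^{(i)}`, `P_com,i`, the copies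
`S_{N_j}^{(i)}`, `F_{N_i}`, `Y_{N_i}`. -/
abbrev AgentVars (i : Fin M) : Type :=
  Matrix (Fin (d.nd i)) (Fin (d.nd i)) ℝ ×
  (∀ j : {j // j ∈ d.cnbhd i}, Matrix (d.Idx j.1) (d.Idx j.1) ℝ) ×
  Matrix (d.Idx i ⊕ Fin (d.nz i)) (d.Idx i ⊕ Fin (d.nz i)) ℝ ×
  (∀ j : {j // j ∈ d.cnbhd i}, Matrix (d.NIdx j.1) (d.NIdx j.1) ℝ) ×
  Matrix (d.NIdx i) (d.NIdx i) ℝ ×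
  Matrix (Fin (d.m i)) (d.NIdx i) ℝ

namespace AgentVars

variable {d} {i : Fin M} (Ξ : d.AgentVars i)

abbrev Φ := Ξ.1
abbrev E := Ξ.2.1
abbrev P := Ξ.2.2.1
abbrev S := Ξ.2.2.2.1
abbrev F := Ξ.2.2.2.2.1
abbrev Y := Ξ.2.2.2.2.2

/-- The own variables `(Φ_i, E_i^{(i)}, P_com,i, S_{N_i}^{(i)}, F_{N_i}, Y_{N_i})`. -/
def own : d.OwnVars i :=
  (Ξ.Φ, Ξ.E ⟨i, d.self_mem_cnbhd i⟩, Ξ.P, Ξ.S ⟨i, d.self_mem_cnbhd i⟩, Ξ.F, Ξ.Y)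

/-- The vector `h_e(Ξ_i)` of the copies that agent `i` holds of the variables of the two end points
of an edge `e` at `i`. -/
def h (e : d.Inc i) : d.EdgeVec e.1 :=
  d.stack e.1 (fun q => Ξ.E ⟨q.1, d.mem_cnbhd_of_endpt e q⟩)
    (fun q => Ξ.S ⟨q.1, d.mem_cnbhd_of_endpt e q⟩)

end AgentVars

/-- The constraint set `C_i`: the matrix inequalities of agent `i` hold for the local copies (and
all the held copies satisfy the domain constraints on `E_j` and `S_{N_j}`). -/
def localSet (ε : ℝ) (i : Fin M) : Set (d.AgentVars i) :=
  {Ξ | d.MarginLMI ε i Ξ.Φ (fun j => Ξ.E ⟨j.1, d.nbhd_subset_cnbhd i j.2⟩) Ξ.P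
      (fun j => Ξ.S ⟨j.1, d.nbhd_subset_cnbhd i j.2⟩) Ξ.F Ξ.Y ∧
    ∀ j, (Ξ.E j - ε • 1).PosSemidef ∧ (Ξ.S j).IsSymm ∧ d.IsBlockDiag j.1 (Ξ.S j)}

/-- All edge variables `ν_e`. -/
abbrev EdgeVars : Type := ∀ e : d.Edge, d.EdgeVec e

/-- All dual variables `μ_{e,i}`, `i` an agent and `e` an edge at `i`. -/
abbrev DualVars : Type := ∀ i : Fin M, ∀ e : d.Inc i, d.EdgeVec e.1

/-- The objective of agent `i` in the first ADMM update. -/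
def agentObjective (α : ℝ) (i : Fin M) (ν : d.EdgeVars) (μ : d.DualVars) (Ξ : d.AgentVars i) : ℝ :=
  Ξ.Φ.trace + ∑ e : d.Inc i,
    (inner ℝ (μ i e) (Ξ.h e - ν e.1) + α / 2 * ‖Ξ.h e - ν e.1‖ ^ 2)

/-- The objective of the edge `e` in the second ADMM update. -/
def edgeObjective (α : ℝ) (e : d.Edge) (Ξ : ∀ i, d.AgentVars i) (μ : d.DualVars)
    (y : d.EdgeVec e) : ℝ :=
  ∑ q : d.Endpt e, (inner ℝ (μ q.1 ⟨e, q.2⟩) ((Ξ q.1).h ⟨e, q.2⟩ - y) +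
    α / 2 * ‖(Ξ q.1).h ⟨e, q.2⟩ - y‖ ^ 2)

/-- Sequences generated by the edge-based ADMM iteration with penalty parameter `α`. -/
structure IsRun (ε α : ℝ) (Ξ : ℕ → ∀ i, d.AgentVars i) (ν : ℕ → d.EdgeVars)
    (μ : ℕ → d.DualVars) : Prop where
  agent_mem : ∀ t i, Ξ (t + 1) i ∈ d.localSet ε i
  agent_min : ∀ t i, IsMinOn (d.agentObjective α i (ν t) (μ t)) (d.localSet ε i) (Ξ (t + 1) i)
  edge_min : ∀ t e, IsMinOn (d.edgeObjective α e (Ξ (t + 1)) (μ t)) Set.univ (ν (t + 1) e)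
  dual : ∀ t i (e : d.Inc i),
    μ (t + 1) i e = μ t i e + α • ((Ξ (t + 1) i).h e - ν (t + 1) e.1)

/-- The variables `(E_q, S_{N_q})` of the two end points of the edge `e`, stacked. -/
def edgeVec (X : d.GlobalVars) (e : d.Edge) : d.EdgeVec e :=
  d.stack e (fun q => (X q.1).E) (fun q => (X q.1).S)

end GrayBox

end GrayBoxADMM

end

/-! Stack the variables of all agents and let `copies` collect the vectors h_e(Ξ_i). The global
problem minimizes a linear cost over a closed convex product set, subject to `copies` lying in the
subspace `consensus`. The edge update makes the dual variables at each edge sum to zero, so from the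
first step on ν lies in this subspace and μ in its orthogonal complement. The iteration is thus a
method of multipliers for the image K of the product set under (cost, copies).

For every saddle point (y, m), the vector z = μ + αν satisfies ‖z⁺ - z*‖² + ‖z⁺ - z‖² ≤ ‖z - z*‖²
with z* = m + αy (`IsSplittingRun.descent`). Hence the steps vanish, a cluster point of z gives
another saddle point, and the monotone distance to it forces convergence of the whole sequence
(`IsSplittingRun.tendsto`). Boundedness of Ξ is not needed: K need not be closed, so saddle points
may have their primal part in its closure.

A saddle point needs a multiplier (`exists_multiplier`). The multiplier matrices P lie in a cone
with two generators, which has empty interior in general, but the consensus constraint involves only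
E and S. A strictly feasible point can be shifted so that the nonstrict inequalities become strict
too (`exists_isSlater`), and it keeps this property for small ε. Its copies of E and S can then be
perturbed with all else fixed. The same point bounds the minimum from above; segments towards it
give the lower bound v.

Compactness of the solution set excludes nonzero recession directions along which the copies vanish
and the cost does not increase (`eq_zero_of_isRecession`). This makes the updates attained and
confines the iterates to a compact set, where cluster points are solutions. -/

noncomputable section

namespace GrayBoxADMM

/-! ### Convergence of the method of multipliers -/

section Splitting

variable {H : Type*} [NormedAddCommGroup H] [InnerProductSpace ℝ H]

lemma inner_eq_zero_of_mem_orthogonal {A : Submodule ℝ H} {u v : H} (hu : u ∈ A) (hv : v ∈ Aᗮ) :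
    inner ℝ u v = 0 ∧ inner ℝ v u = 0 :=
  ⟨Submodule.inner_right_of_mem_orthogonal hu hv, Submodule.inner_left_of_mem_orthogonal hu hv⟩

/-- A sequence generated by the method of multipliers for minimizing the first component over
the points of `K` whose second component lies in the subspace `A`, the updates being expressed by
their optimality conditions. -/
structure IsSplittingRun (K : Set (ℝ × H)) (A : Submodule ℝ H) (α : ℝ) (c : ℕ → ℝ)
    (x ν μ : ℕ → H) : Prop where
  ν_mem : ∀ t, ν t ∈ A
  μ_mem : ∀ t, μ t ∈ Aᗮ
  mem : ∀ t, (c (t + 1), x (t + 1)) ∈ K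
  dual : ∀ t, μ (t + 1) = μ t + α • (x (t + 1) - ν (t + 1))
  var : ∀ t, ∀ y ∈ K,
    0 ≤ y.1 - c (t + 1) + inner ℝ (μ (t + 1) + α • (ν (t + 1) - ν t)) (y.2 - x (t + 1))

/-- A primal-dual solution `(y, m)` with optimal value `p`, where the primal part need only be
attained in the closure of `K`. -/
structure IsSaddle (K : Set (ℝ × H)) (A : Submodule ℝ H) (p : ℝ) (y m : H) : Prop where
  mem_closure : (p, y) ∈ closure K
  y_mem : y ∈ A
  m_mem : m ∈ Aᗮ
  le : ∀ k ∈ K, p ≤ k.1 + inner ℝ m k.2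

variable {K : Set (ℝ × H)} {A : Submodule ℝ H} {α p : ℝ} {c : ℕ → ℝ} {x ν μ : ℕ → H} {y m : H}

/-- The inequality is closed in the competitor, so it extends to the closure of K, where the primal
part of a saddle point lies. -/
lemma IsSplittingRun.upper (h : IsSplittingRun K A α c x ν μ) (hs : (p, y) ∈ closure K) (t : ℕ) :
    0 ≤ p - c (t + 1) + inner ℝ (μ (t + 1) + α • (ν (t + 1) - ν t)) (y - x (t + 1)) := by
  have hc : IsClosed {k : ℝ × H | 0 ≤ k.1 - c (t + 1) +
      inner ℝ (μ (t + 1) + α • (ν (t + 1) - ν t)) (k.2 - x (t + 1))} :=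
    isClosed_le (by fun_prop) (by fun_prop)
  exact closure_minimal (fun k hk => h.var t k hk) hc hs

/-- Adding the saddle inequality at the new iterate to the optimality condition tested at (p, y)
eliminates the costs. By orthogonality of A and Aᗮ, what remains is ⟨z⁺ - z, z* - z⁺⟩ ≥ 0 for z = μ
+ αν and z* = m + αy. -/
lemma IsSplittingRun.descent (hα : 0 < α) (h : IsSplittingRun K A α c x ν μ)
    (hs : IsSaddle K A p y m) (t : ℕ) :
    ‖μ (t + 1) + α • ν (t + 1) - (m + α • y)‖ ^ 2 +
      ‖μ (t + 1) + α • ν (t + 1) - (μ t + α • ν t)‖ ^ 2 ≤ ‖μ t + α • ν t - (m + α • y)‖ ^ 2 := by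
  have h1 := hs.le _ (h.mem t)
  have h2 := h.upper hs.mem_closure t
  -- The dual update splits αx into a part in A and the increment of μ, which lies in Aᗮ.
  have hd : α • x (t + 1) = α • ν (t + 1) + (μ (t + 1) - μ t) := by
    rw [h.dual t]; module
  have h3 : 0 ≤ inner ℝ m (α • x (t + 1)) +
      inner ℝ (μ (t + 1) + α • (ν (t + 1) - ν t)) (α • y - α • x (t + 1)) := by
    rw [← smul_sub, real_inner_smul_right, real_inner_smul_right]
    nlinarith
  rw [hd] at h3
  have o := fun {u v : H} (hu : u ∈ A) (hv : v ∈ Aᗮ) => inner_eq_zero_of_mem_orthogonal hu hv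
  have hy := hs.y_mem
  have hm := hs.m_mem
  have n0 := h.ν_mem t
  have n1 := h.ν_mem (t + 1)
  have m0 := h.μ_mem t
  have m1 := h.μ_mem (t + 1)
  generalize μ (t + 1) = b at *
  generalize μ t = a at *
  generalize ν (t + 1) = k at *
  generalize ν t = n at *
  have e : ‖b + α • k - (m + α • y)‖ ^ 2 + ‖b + α • k - (a + α • n)‖ ^ 2 -
      ‖a + α • n - (m + α • y)‖ ^ 2 = -2 * inner ℝ ((b - a) + α • (k - n)) ((m - b) + α • (y - k)) := by
    have e1 : a + α • n - (m + α • y) =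
      -(((b - a) + α • (k - n)) + ((m - b) + α • (y - k))) := by module
    have e2 : b + α • k - (m + α • y) = -((m - b) + α • (y - k)) := by module
    have e3 : b + α • k - (a + α • n) = (b - a) + α • (k - n) := by module
    rw [e1, e2, e3, norm_neg, norm_neg, norm_add_sq_real ((b - a) + α • (k - n))]
    ring
  have e' : inner ℝ ((b - a) + α • (k - n)) ((m - b) + α • (y - k)) =
      inner ℝ m (α • k + (b - a)) + inner ℝ (b + α • (k - n)) (α • y - (α • k + (b - a))) := by
    simp only [inner_add_left, inner_add_right, inner_sub_left, inner_sub_right,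
      real_inner_smul_left, real_inner_smul_right, o hy m0, o hy m1, o n0 hm, o n0 m0,
      o n0 m1, o n1 hm, o n1 m0, o n1 m1]
    rw [real_inner_comm m b, real_inner_comm m a, real_inner_comm b a]
    ring
  linarith

/-- Convergence of the method of multipliers. -/
theorem IsSplittingRun.tendsto [FiniteDimensional ℝ H] (hα : 0 < α)
    (h : IsSplittingRun K A α c x ν μ) (hs : IsSaddle K A p y m) :
    Tendsto c atTop (𝓝 p) ∧ ∃ ν' ∈ A, Tendsto ν atTop (𝓝 ν') ∧ Tendsto x atTop (𝓝 ν') := by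
  -- The components of z in A and Aᗮ are αν and μ, so both are recovered from z by projection.
  set z : ℕ → H := fun t => μ t + α • ν t with hz
  have Qz : ∀ t, A.starProjection (z t) = α • ν t := fun t => by
    simp only [hz, map_add, map_smul]
    rw [Submodule.starProjection_eq_self_iff.2 (h.ν_mem t),
      (Submodule.starProjection_apply_eq_zero_iff (K := A)).2 (h.μ_mem t), zero_add]
  have νz : ∀ t, ν t = α⁻¹ • A.starProjection (z t) := fun t => by
    rw [Qz, smul_smul, inv_mul_cancel₀ hα.ne', one_smul]
  have μz : ∀ t, μ t = z t - A.starProjection (z t) := fun t => by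
    rw [Qz]; simp [hz]
  -- Stated for every saddle point, because it is applied again to the one obtained as a limit.
  have anti : ∀ {y m : H}, IsSaddle K A p y m →
      Antitone fun t => ‖z t - (m + α • y)‖ ^ 2 := fun hs =>
    antitone_nat_of_succ_le fun t => by
      have := h.descent hα hs t
      have h0 := sq_nonneg ‖μ (t + 1) + α • ν (t + 1) - (μ t + α • ν t)‖
      simp only [hz]; linarith
  obtain ⟨l, hl⟩ : ∃ l, Tendsto (fun t => ‖z t - (m + α • y)‖ ^ 2) atTop (𝓝 l) :=
    ⟨_, tendsto_atTop_ciInf (anti hs) ⟨0, by rintro _ ⟨t, rfl⟩; positivity⟩⟩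
  have hΔ2 : Tendsto (fun t => ‖z (t + 1) - z t‖ ^ 2) atTop (𝓝 0) := by
    refine squeeze_zero (fun t => sq_nonneg _) (fun t => ?_)
      (by simpa using hl.sub (hl.comp (tendsto_add_atTop_nat 1)))
    have := h.descent hα hs t
    simp only [hz]; linarith
  have hΔ : Tendsto (fun t => z (t + 1) - z t) atTop (𝓝 0) := by
    rw [tendsto_zero_iff_norm_tendsto_zero]
    simpa using hΔ2.sqrt
  have hQ : Continuous (A.starProjection) := A.starProjection.continuous
  have hΔν : Tendsto (fun t => ν (t + 1) - ν t) atTop (𝓝 0) := by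
    have := ((hQ.tendsto 0).comp hΔ).const_smul α⁻¹
    simpa [Function.comp_def, νz, smul_sub] using this
  have hΔμ : Tendsto (fun t => μ (t + 1) - μ t) atTop (𝓝 0) := by
    have := hΔ.sub ((hQ.tendsto 0).comp hΔ)
    simp only [Function.comp_def, map_sub, map_zero, sub_zero] at this
    refine this.congr fun t => ?_
    rw [μz, μz]; abel
  have hr : Tendsto (fun t => x (t + 1) - ν (t + 1)) atTop (𝓝 0) := by
    have := hΔμ.const_smul α⁻¹
    rw [smul_zero] at this
    refine this.congr fun t => ?_
    rw [h.dual t, add_sub_cancel_left, smul_smul, inv_mul_cancel₀ hα.ne', one_smul]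
  have hxν : Tendsto (fun t => x (t + 1) - ν t) atTop (𝓝 0) := by
    simpa using hr.add hΔν
  obtain ⟨R, hR⟩ : ∃ R, ∀ t, ‖z t‖ ≤ R := by
    refine ⟨‖z 0 - (m + α • y)‖ + ‖m + α • y‖, fun t => ?_⟩
    have h1 := (sq_le_sq₀ (norm_nonneg _) (norm_nonneg _)).1 (anti hs (Nat.zero_le t))
    have h2 := norm_add_le (z t - (m + α • y)) (m + α • y)
    rw [sub_add_cancel] at h2
    linarith
  obtain ⟨z', -, φ, hφ, hzφ⟩ := tendsto_subseq_of_bounded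
    (isBounded_iff_forall_norm_le.2 ⟨R, by rintro _ ⟨t, rfl⟩; exact hR t⟩ :
      Bornology.IsBounded (Set.range z)) (fun t => Set.mem_range_self t)
  -- The lower bound is the saddle inequality at the iterate, the upper bound the optimality
  -- condition tested at (p, y).
  have hc : Tendsto (fun t => c (t + 1)) atTop (𝓝 p) := by
    refine tendsto_of_tendsto_of_tendsto_of_le_of_le
      (g := fun t => p - inner ℝ m (x (t + 1) - ν (t + 1)))
      (h := fun t => p + (-inner ℝ (μ (t + 1)) (x (t + 1) - ν (t + 1)) +
        α * inner ℝ (ν (t + 1) - ν t) (y - x (t + 1)))) ?_ ?_ (fun t => ?_) fun t => ?_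
    · simpa using tendsto_const_nhds.sub (Tendsto.inner (𝕜 := ℝ) (tendsto_const_nhds (x := m)) hr)
    · have bμ : IsBoundedUnder (· ≤ ·) atTop fun t => ‖μ (t + 1)‖ := by
        refine isBoundedUnder_of ⟨R + ‖A.starProjection‖ * R, fun t => ?_⟩
        rw [μz]
        exact (norm_sub_le _ _).trans (add_le_add (hR _) ((A.starProjection.le_opNorm _).trans
          (by gcongr; exact hR _)))
      have bx : IsBoundedUnder (· ≤ ·) atTop fun t => ‖y - x (t + 1)‖ := by
        obtain ⟨B, hB⟩ := hr.norm.isBoundedUnder_le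
        refine ⟨‖y‖ + (B + |α⁻¹| * (‖A.starProjection‖ * R)), ?_⟩
        simp only [eventually_map] at hB ⊢
        filter_upwards [hB] with t ht
        have h1 := norm_sub_le y (x (t + 1))
        have h2 := norm_add_le (x (t + 1) - ν (t + 1)) (ν (t + 1))
        rw [sub_add_cancel] at h2
        have h3 : ‖ν (t + 1)‖ ≤ |α⁻¹| * (‖A.starProjection‖ * R) := by
          rw [νz, norm_smul, Real.norm_eq_abs]
          gcongr
          exact (A.starProjection.le_opNorm _).trans (by gcongr; exact hR _)
        linarith
      have t1 : Tendsto (fun t => inner ℝ (μ (t + 1)) (x (t + 1) - ν (t + 1))) atTop (𝓝 0) := by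
        refine squeeze_zero_norm (fun t => norm_inner_le_norm _ _) ?_
        simp only [mul_comm ‖μ _‖]
        exact Tendsto.zero_mul_isBoundedUnder_le (by simpa using hr.norm)
          (by simpa [Function.comp_def] using bμ)
      have t2 : Tendsto (fun t => inner ℝ (ν (t + 1) - ν t) (y - x (t + 1))) atTop (𝓝 0) := by
        refine squeeze_zero_norm (fun t => norm_inner_le_norm _ _) ?_
        exact Tendsto.zero_mul_isBoundedUnder_le (by simpa using hΔν.norm)
          (by simpa [Function.comp_def] using bx)
      simpa using tendsto_const_nhds.add (t1.neg.add (t2.const_mul α))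
    · have h1 := hs.le _ (h.mem t)
      simp only [inner_sub_right, (inner_eq_zero_of_mem_orthogonal (h.ν_mem (t + 1)) hs.m_mem).2]
      linarith
    · have h1 := h.upper hs.mem_closure t
      have e1 := (inner_eq_zero_of_mem_orthogonal hs.y_mem (h.μ_mem (t + 1))).2
      have e2 := (inner_eq_zero_of_mem_orthogonal (h.ν_mem (t + 1)) (h.μ_mem (t + 1))).2
      rw [inner_add_left, real_inner_smul_left, inner_sub_right (μ (t + 1)), e1] at h1
      beta_reduce
      rw [inner_sub_right (μ (t + 1)), e2]
      linarith
  set ν' : H := α⁻¹ • A.starProjection z' with hν'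
  have hνφ : Tendsto (fun k => ν (φ k)) atTop (𝓝 ν') := by
    simp only [νz]
    exact ((hQ.tendsto _).comp hzφ).const_smul _
  have hμφ : Tendsto (fun k => μ (φ k)) atTop (𝓝 (z' - A.starProjection z')) := by
    simp only [μz]
    exact hzφ.sub ((hQ.tendsto _).comp hzφ)
  have hxφ : Tendsto (fun k => x (φ k + 1)) atTop (𝓝 ν') := by
    simpa using (hxν.comp hφ.tendsto_atTop).add hνφ
  have hν'A : ν' ∈ A := A.smul_mem _ (Submodule.starProjection_apply_mem _ _)
  have hm' : z' - A.starProjection z' ∈ Aᗮ := Submodule.sub_starProjection_mem_orthogonal _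
  -- In the limit along the subsequence the optimality conditions become the saddle inequality.
  have hs' : IsSaddle K A p ν' (z' - A.starProjection z') := by
    refine ⟨?_, hν'A, hm', fun k hk => ?_⟩
    · exact mem_closure_of_tendsto ((hc.comp hφ.tendsto_atTop).prodMk_nhds hxφ)
        (Eventually.of_forall fun k => h.mem (φ k))
    · have h1 : Tendsto (fun j => k.1 - c (φ j + 1) + inner ℝ (μ (φ j) + (μ (φ j + 1) - μ (φ j)) +
          α • (ν (φ j + 1) - ν (φ j))) (k.2 - x (φ j + 1))) atTop
          (𝓝 (k.1 - p + inner ℝ (z' - A.starProjection z' + 0 + α • (0 : H)) (k.2 - ν'))) := by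
        refine (tendsto_const_nhds.sub (hc.comp hφ.tendsto_atTop)).add
          (Tendsto.inner ?_ (tendsto_const_nhds.sub hxφ))
        exact (hμφ.add (hΔμ.comp hφ.tendsto_atTop)).add
          ((hΔν.comp hφ.tendsto_atTop).const_smul α)
      have h2 := ge_of_tendsto h1 (b := 0) (Eventually.of_forall fun j => by
        have := h.var (φ j) k hk
        rwa [add_sub_cancel])
      simp only [add_zero, smul_zero] at h2
      rw [inner_sub_right, (inner_eq_zero_of_mem_orthogonal hν'A hm').2] at h2
      linarith
  -- For the new saddle point m + αy is z' itself, so the distance to z' is monotone and vanishes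
  -- along a subsequence.
  have hzlim : Tendsto z atTop (𝓝 z') := by
    have e : z' - A.starProjection z' + α • ν' = z' := by
      rw [hν', smul_smul, mul_inv_cancel₀ hα.ne', one_smul, sub_add_cancel]
    have h1 := anti hs'
    rw [e] at h1
    have h2 : Tendsto (fun t => ‖z t - z'‖ ^ 2) atTop (𝓝 0) := by
      rw [tendsto_iff_tendsto_subseq_of_antitone h1 hφ.tendsto_atTop]
      simpa [Function.comp_def] using ((hzφ.sub_const z').norm.pow 2)
    rw [tendsto_iff_norm_sub_tendsto_zero]
    simpa using h2.sqrt
  have hν : Tendsto ν atTop (𝓝 ν') := by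
    have := ((hQ.tendsto _).comp hzlim).const_smul α⁻¹
    exact this.congr fun t => (νz t).symm
  refine ⟨(tendsto_add_atTop_iff_nat 1).1 hc, ν', hν'A, hν, (tendsto_add_atTop_iff_nat 1).1 ?_⟩
  simpa using hr.add (hν.comp (tendsto_add_atTop_nat 1))

end Splitting

/-! ### Lagrange multipliers by separation -/

section Multiplier

variable {V H : Type*} [AddCommGroup V] [Module ℝ V]
  [NormedAddCommGroup H] [InnerProductSpace ℝ H] [FiniteDimensional ℝ H]

/-- A linear functional that vanishes on the preimage of a subspace `A` is represented by a vector
orthogonal to `A`. -/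
lemma exists_inner_eq_of_vanish (A : Submodule ℝ H) (L : V →ₗ[ℝ] H) (g : V →ₗ[ℝ] ℝ)
    (hg : ∀ v, L v ∈ A → g v = 0) : ∃ m ∈ Aᗮ, ∀ v, g v = inner ℝ m (L v) := by
  -- After projection onto Aᗮ the kernel is exactly the preimage of A, so g factors through T.
  set T : V →ₗ[ℝ] H := (Aᗮ.starProjection : H →ₗ[ℝ] H) ∘ₗ L with hT
  have h1 : g ∈ LinearMap.range T.dualMap := by
    rw [LinearMap.range_dualMap_eq_dualAnnihilator_ker, Submodule.mem_dualAnnihilator]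
    intro v hv
    refine hg v ?_
    have : Aᗮ.starProjection (L v) = 0 := hv
    rw [Submodule.starProjection_apply_eq_zero_iff, Submodule.orthogonal_orthogonal] at this
    exact this
  obtain ⟨ψ, rfl⟩ := h1
  set w : H := (InnerProductSpace.toDual ℝ H).symm (LinearMap.toContinuousLinearMap ψ) with hw
  refine ⟨Aᗮ.starProjection w, Submodule.starProjection_apply_mem _ _, fun v => ?_⟩
  rw [Submodule.inner_starProjection_left_eq_right, hw, InnerProductSpace.toDual_symm_apply]
  rfl

/-- Existence of a Lagrange multiplier for the constraint `L x ∈ A`, under a Slater condition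
that concerns only the perturbations of the constraint. -/
theorem exists_multiplier [TopologicalSpace V] [IsTopologicalAddGroup V] [ContinuousSMul ℝ V]
    {C : Set V} (hC : Convex ℝ C) (f : V →ₗ[ℝ] ℝ) (L : V →ₗ[ℝ] H)
    (A : Submodule ℝ H) {p c₁ : ℝ} (hp : ∀ x ∈ C, L x ∈ A → p ≤ f x)
    (hs : ∀ᶠ v in 𝓝 (0 : V), ∃ y ∈ C, f y ≤ c₁ ∧ L y - L v ∈ A) :
    ∃ m ∈ Aᗮ, ∀ x ∈ C, p ≤ f x + inner ℝ m (L x) := by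
  -- The strict epigraph of the value function. Perturbations are parametrized by V rather than H,
  -- so O can have interior even if L does not reach all of H.
  set O : Set (ℝ × V) := {q | ∃ x ∈ C, f x < q.1 ∧ L x - L q.2 ∈ A} with hO
  have hOc : Convex ℝ O := by
    rintro ⟨s, v⟩ ⟨x, hx, hxs, hxv⟩ ⟨s', v'⟩ ⟨x', hx', hxs', hxv'⟩ a b ha hb hab
    refine ⟨a • x + b • x', hC hx hx' ha hb hab, ?_, ?_⟩
    · simp only [map_add, map_smul, Prod.smul_mk, Prod.mk_add_mk, smul_eq_mul] at *
      rcases ha.eq_or_lt with rfl | ha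
      · have : b = 1 := by linarith
        subst this; linarith
      · have h1 := mul_lt_mul_of_pos_left hxs ha
        have h2 := mul_le_mul_of_nonneg_left hxs'.le hb
        linarith
    · have := A.add_mem (A.smul_mem a hxv) (A.smul_mem b hxv')
      simp only [map_add, map_smul, Prod.smul_mk, Prod.mk_add_mk] at *
      convert this using 1
      module
  have hpO : (p, (0 : V)) ∉ O := by
    rintro ⟨x, hx, hlt, hA⟩
    rw [map_zero, sub_zero] at hA
    exact absurd (hp x hx hA) (not_le.2 hlt)
  obtain ⟨y₀, hy₀C, hy₀, hy₀A⟩ := hs.self_of_nhds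
  rw [map_zero, sub_zero] at hy₀A
  have hpc : p ≤ c₁ := (hp y₀ hy₀C hy₀A).trans hy₀
  have hint : (c₁ + 1, (0 : V)) ∈ interior O := by
    rw [mem_interior_iff_mem_nhds, nhds_prod_eq]
    filter_upwards [(lt_mem_nhds (by linarith : c₁ < c₁ + 1)).prod_mk hs] with q hq
    obtain ⟨h1, y, hy, hyc, hyA⟩ := hq
    exact ⟨y, hy, hyc.trans_lt h1, hyA⟩
  obtain ⟨F, hF⟩ := geometric_hahn_banach_open_point hOc.interior isOpen_interior
    (fun h => hpO (interior_subset h))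
  have hFO : ∀ q ∈ O, F q ≤ F (p, 0) := by
    have hcl : closure (interior O) ⊆ {q | F q ≤ F (p, 0)} :=
      closure_minimal (fun q hq => (hF q hq).le) (isClosed_le F.continuous continuous_const)
    rw [hOc.closure_interior_eq_closure_of_nonempty_interior ⟨_, hint⟩] at hcl
    exact fun q hq => hcl (subset_closure hq)
  set a₀ : ℝ := F (1, 0) with ha₀
  have hFe : ∀ s v, F (s, v) = s * a₀ + F (0, v) := fun s v => by
    have : ((s, v) : ℝ × V) = s • ((1, 0) : ℝ × V) + (0, v) := by simp
    rw [this, map_add, map_smul, smul_eq_mul]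
  have hF0 : F ((0 : ℝ), (0 : V)) = 0 := map_zero F
  -- The separating hyperplane is not vertical, since an interior point of O lies directly above (p,
  -- 0).
  have ha : a₀ < 0 := by
    have := hF _ hint
    rw [hFe, hFe p, hF0] at this
    nlinarith
  set g : V →ₗ[ℝ] ℝ := a₀⁻¹ • ((F : ℝ × V →ₗ[ℝ] ℝ) ∘ₗ LinearMap.inr ℝ ℝ V) with hg
  have hgv : ∀ v, F (0, v) = a₀ * g v := fun v => by
    simp [hg, ha.ne]
  have key : ∀ x ∈ C, ∀ v, L x - L v ∈ A → p ≤ f x + g v := by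
    intro x hx v hv
    refine le_of_forall_pos_le_add fun ε hε => ?_
    have := hFO (f x + ε, v) ⟨x, hx, by simpa using hε, hv⟩
    rw [hFe, hFe p, hF0, hgv] at this
    nlinarith
  -- If L v ∈ A, then v may be scaled freely; with g v ≠ 0, the scalar below would bring the right
  -- side of `key` at y₀ down to p - 1.
  obtain ⟨m, hm, hgm⟩ := exists_inner_eq_of_vanish A L g fun v hv => by
    by_contra hne
    have := key y₀ hy₀C ((-(f y₀ - p + 1) / g v) • v) (by
      rw [map_smul]; exact A.sub_mem hy₀A (A.smul_mem _ hv))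
    rw [map_smul, smul_eq_mul, div_mul_cancel₀ _ hne] at this
    linarith
  refine ⟨m, hm, fun x hx => ?_⟩
  rw [← hgm]
  exact key x hx x (by simp)

end Multiplier

/-! ### Directions of recession and minimization of the augmented Lagrangian -/

section Recession

variable {E : Type*} [AddCommGroup E] [Module ℝ E]

/-- `D` is a direction of recession of `C`. -/
def IsRecession (C : Set E) (D : E) : Prop := ∀ y ∈ C, ∀ n : ℕ, y + (n : ℝ) • D ∈ C

variable [TopologicalSpace E] [IsTopologicalAddGroup E] [ContinuousSMul ℝ E]

/-- The convex combinations (1 - ns)y + nsx lie in C and converge to y + nD. -/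
lemma isRecession_of_tendsto {C : Set E} (hC : Convex ℝ C) (hcl : IsClosed C) {x : ℕ → E}
    {s : ℕ → ℝ} {D : E} (hx : ∀ k, x k ∈ C) (hs : ∀ k, 0 < s k) (hs0 : Tendsto s atTop (𝓝 0))
    (hD : Tendsto (fun k => s k • x k) atTop (𝓝 D)) : IsRecession C D := by
  intro y hy n
  have h1 : Tendsto (fun k => (1 - n * s k) • y + (n : ℝ) • (s k • x k)) atTop
      (𝓝 ((1 - (n : ℝ) * 0) • y + (n : ℝ) • D)) :=
    ((tendsto_const_nhds.sub (hs0.const_mul _)).smul_const y).add (hD.const_smul _)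
  rw [mul_zero, sub_zero, one_smul] at h1
  refine hcl.mem_of_tendsto h1 ?_
  have h2 : ∀ᶠ k in atTop, (n : ℝ) * s k < 1 :=
    (hs0.const_mul (n : ℝ)).eventually_lt_const (by simp)
  filter_upwards [h2] with k hk
  rw [smul_smul]
  exact hC hy (hx k) (by linarith) (mul_nonneg (Nat.cast_nonneg _) (hs k).le) (by ring)

variable [T2Space E] [FiniteDimensional ℝ E]

/-- In an unbounded set, points with norms tending to infinity, divided by these norms, accumulate
on the unit sphere. The norm is that of Euclidean coordinates. -/
lemma isCompact_or_exists_direction {S : Set E} (hS : IsClosed S) :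
    IsCompact S ∨ ∃ (x : ℕ → E) (s : ℕ → ℝ) (D : E), (∀ k, x k ∈ S) ∧ (∀ k, 0 < s k) ∧
      Tendsto s atTop (𝓝 0) ∧ Tendsto (fun k => s k • x k) atTop (𝓝 D) ∧ D ≠ 0 := by
  set e : E ≃L[ℝ] _ := toEuclidean (E := E) with he
  by_cases hb : Bornology.IsBounded (e '' S)
  · left
    have h1 : IsClosed (e '' S) := (e.toHomeomorph.isClosed_image).2 hS
    have h2 := (Metric.isCompact_of_isClosed_isBounded h1 hb).image e.symm.continuous
    rwa [Set.image_image, show (fun x => e.symm (e x)) = id from funext fun x => by simp,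
      Set.image_id] at h2
  · right
    have h1 : ∀ k : ℕ, ∃ x ∈ S, (k : ℝ) + 1 < ‖e x‖ := by
      intro k
      by_contra! h
      exact hb (isBounded_iff_forall_norm_le.2 ⟨k + 1, by rintro _ ⟨x, hx, rfl⟩; exact h x hx⟩)
    choose x hxS hx using h1
    have hpos : ∀ k, 0 < ‖e (x k)‖ := fun k => lt_trans (by positivity) (hx k)
    have hsph : ∀ k, ‖e (x k)‖⁻¹ • e (x k) ∈ Metric.sphere
        (0 : EuclideanSpace ℝ (Fin (Module.finrank ℝ E))) 1 := fun k => by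
      simp [norm_smul, (hpos k).ne']
    obtain ⟨u, hu, φ, hφ, hlim⟩ := (isCompact_sphere _ _).tendsto_subseq hsph
    refine ⟨fun k => x (φ k), fun k => ‖e (x (φ k))‖⁻¹, e.symm u, fun k => hxS _,
      fun k => inv_pos.2 (hpos _), ?_, ?_, ?_⟩
    · refine tendsto_inv_atTop_zero.comp (tendsto_atTop_mono (fun k => ?_)
        (tendsto_natCast_atTop_atTop (R := ℝ)))
      have h2 : (k : ℝ) ≤ φ k := by exact_mod_cast hφ.id_le k
      linarith [hx (φ k)]
    · have := (e.symm.continuous.tendsto u).comp hlim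
      simpa [Function.comp_def] using this
    · intro h
      have : u = 0 := by simpa using congrArg e h
      simp [this] at hu

variable {H : Type*} [NormedAddCommGroup H] [InnerProductSpace ℝ H]

/-- A closed subset of a closed convex set `C` on which `f + β ‖L‖²` grows at most linearly in
`‖L‖` is compact if `C` has no direction of recession in the kernel of `L` along which `f` does not
increase. -/
theorem isCompact_of_no_recession {C S : Set E} (hC : Convex ℝ C) (hcl : IsClosed C)
    (hSC : S ⊆ C) (hS : IsClosed S) (f : E →ₗ[ℝ] ℝ) (L : E →ₗ[ℝ] H) {β a b : ℝ} (hβ : 0 < β)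
    (hbd : ∀ x ∈ S, f x + β * ‖L x‖ ^ 2 ≤ a + b * ‖L x‖)
    (hrec : ∀ D, IsRecession C D → L D = 0 → f D ≤ 0 → D = 0) : IsCompact S := by
  refine (isCompact_or_exists_direction hS).resolve_right ?_
  rintro ⟨x, s, D, hx, hs, hs0, hD, hD0⟩
  have hf : Tendsto (fun k => f (s k • x k)) atTop (𝓝 (f D)) :=
    ((LinearMap.continuous_of_finiteDimensional f).tendsto D).comp hD
  have hL : Tendsto (fun k => ‖L (s k • x k)‖) atTop (𝓝 ‖L D‖) :=
    (((LinearMap.continuous_of_finiteDimensional L).tendsto D).comp hD).norm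
  have e : ∀ k, ‖L (s k • x k)‖ = s k * ‖L (x k)‖ := fun k => by
    rw [map_smul, norm_smul, Real.norm_of_nonneg (hs k).le]
  -- Multiplied by s², the growth bound leaves only β‖L D‖² ≤ 0 in the limit.
  have hLD : L D = 0 := by
    have h2 := le_of_tendsto_of_tendsto' ((hs0.mul hf).add ((hL.pow 2).const_mul β))
      (((hs0.pow 2).mul_const a).add ((hs0.mul hL).mul_const b)) (fun k => by
        have := mul_le_mul_of_nonneg_left (hbd (x k) (hx k)) (sq_nonneg (s k))
        rw [e, map_smul, smul_eq_mul]
        linarith)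
    simp only [zero_mul, zero_add, ne_eq, OfNat.ofNat_ne_zero, not_false_eq_true, zero_pow] at h2
    have h3 : ‖L D‖ ^ 2 ≤ 0 := by nlinarith
    simpa using le_antisymm h3 (sq_nonneg _)
  refine hD0 (hrec D (isRecession_of_tendsto hC hcl (fun k => hSC (hx k)) hs hs0 hD) hLD ?_)
  -- Multiplied by s only, with the quadratic term dropped, it leaves f D ≤ b‖L D‖ = 0.
  have h2 := le_of_tendsto_of_tendsto' hf ((hs0.mul_const a).add (hL.mul_const b)) (fun k => by
    have h3 : f (x k) ≤ a + b * ‖L (x k)‖ := by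
      have := hbd (x k) (hx k)
      have : 0 ≤ β * ‖L (x k)‖ ^ 2 := by positivity
      linarith
    have := mul_le_mul_of_nonneg_left h3 (hs k).le
    rw [e, map_smul, smul_eq_mul]
    linarith)
  simpa [hLD] using h2

/-- The augmented Lagrangian attains its minimum on a closed convex set without bad directions of
recession. -/
theorem exists_isMinOn_augmented {C : Set E} (hC : Convex ℝ C) (hcl : IsClosed C)
    (hne : C.Nonempty) (f : E →ₗ[ℝ] ℝ) (L : E →ₗ[ℝ] H) (ν m : H) {α : ℝ} (hα : 0 < α)
    (hrec : ∀ D, IsRecession C D → L D = 0 → f D ≤ 0 → D = 0) :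
    ∃ x ∈ C, IsMinOn (fun x => f x + (inner ℝ m (L x - ν) + α / 2 * ‖L x - ν‖ ^ 2)) C x := by
  obtain ⟨x₀, hx₀⟩ := hne
  set J : E → ℝ := fun x => f x + (inner ℝ m (L x - ν) + α / 2 * ‖L x - ν‖ ^ 2) with hJ
  have hfc := LinearMap.continuous_of_finiteDimensional f
  have hLc := LinearMap.continuous_of_finiteDimensional L
  have hJc : Continuous J := by
    simp only [hJ]
    fun_prop
  have hcomp : IsCompact (C ∩ {x | J x ≤ J x₀}) := by
    -- The constants come from expanding the square and applying Cauchy–Schwarz to the two terms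
    -- linear in L x.
    refine isCompact_of_no_recession (β := α / 2)
      (a := J x₀ + inner ℝ m ν - α / 2 * ‖ν‖ ^ 2) (b := ‖m‖ + α * ‖ν‖)
      hC hcl Set.inter_subset_left
      (hcl.inter (isClosed_le hJc continuous_const)) f L (by positivity) ?_ hrec
    rintro x ⟨-, hx⟩
    simp only [Set.mem_ofPred_eq, hJ] at hx ⊢
    rw [norm_sub_sq_real (L x), inner_sub_right] at hx
    have h1 := neg_le_of_abs_le (abs_real_inner_le_norm m (L x))
    have h2 := mul_le_mul_of_nonneg_left (real_inner_le_norm (L x) ν) hα.le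
    linarith
  obtain ⟨x, ⟨hxC, hxJ⟩, hmin⟩ := hcomp.exists_isMinOn ⟨x₀, hx₀, le_refl (J x₀)⟩ hJc.continuousOn
  refine ⟨x, hxC, fun y hy => ?_⟩
  by_cases h : J y ≤ J x₀
  · exact hmin ⟨hy, h⟩
  · exact le_trans hxJ (not_le.1 h).le

/-- First-order optimality condition for the augmented Lagrangian. -/
lemma variational_of_isMinOn_augmented {V : Type*} [AddCommGroup V] [Module ℝ V] {C : Set V}
    (hC : Convex ℝ C) (f : V →ₗ[ℝ] ℝ)
    (L : V →ₗ[ℝ] H) (ν m : H) {α : ℝ} {x : V} (hx : x ∈ C)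
    (hmin : IsMinOn (fun x => f x + (inner ℝ m (L x - ν) + α / 2 * ‖L x - ν‖ ^ 2)) C x) :
    ∀ y ∈ C, 0 ≤ f y - f x + inner ℝ (m + α • (L x - ν)) (L y - L x) := by
  intro y hy
  -- Minimality along the segment from x to y, divided by s; the quadratic term disappears as s
  -- tends to 0.
  have key : ∀ s : ℝ, 0 < s → s < 1 → 0 ≤ f y - f x + inner ℝ (m + α • (L x - ν)) (L y - L x) +
      s * (α / 2 * ‖L y - L x‖ ^ 2) := by
    intro s hs hs1
    have h1 : f x + (inner ℝ m (L x - ν) + α / 2 * ‖L x - ν‖ ^ 2) ≤ _ :=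
      hmin (hC hx hy (by linarith : 0 ≤ 1 - s) hs.le (by ring))
    have e1 : L ((1 - s) • x + s • y) - ν = (L x - ν) + s • (L y - L x) := by
      simp only [map_add, map_smul]; module
    have e2 : f ((1 - s) • x + s • y) = f x + s * (f y - f x) := by
      simp only [map_add, map_smul, smul_eq_mul]; ring
    simp only [e1, e2] at h1
    rw [norm_add_sq_real, inner_add_right, real_inner_smul_right, real_inner_smul_right, norm_smul,
      mul_pow, Real.norm_eq_abs, sq_abs] at h1
    rw [inner_add_left, real_inner_smul_left]
    have h2 : 0 ≤ s * (f y - f x + (inner ℝ m (L y - L x) + α * inner ℝ (L x - ν) (L y - L x)) +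
      s * (α / 2 * ‖L y - L x‖ ^ 2)) := by linarith
    exact nonneg_of_mul_nonneg_right h2 hs
  have hl : Tendsto (fun s : ℝ => f y - f x + inner ℝ (m + α • (L x - ν)) (L y - L x) +
      s * (α / 2 * ‖L y - L x‖ ^ 2)) (𝓝[>] 0)
      (𝓝 (f y - f x + inner ℝ (m + α • (L x - ν)) (L y - L x) +
      0 * (α / 2 * ‖L y - L x‖ ^ 2))) := by
    refine Tendsto.mono_left ?_ nhdsWithin_le_nhds
    exact (Continuous.tendsto (by fun_prop) 0)
  rw [zero_mul, add_zero] at hl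
  refine ge_of_tendsto hl ?_
  filter_upwards [Ioo_mem_nhdsGT (zero_lt_one' ℝ)] with s hs
  exact key s hs.1 hs.2

end Recession

/-! ### The edge update -/

section Average

variable {Q H : Type*} [Fintype Q] [NormedAddCommGroup H] [InnerProductSpace ℝ H]

lemma sum_augmented_add (μ x : Q → H) (α : ℝ) (y w : H) :
    ∑ q, (inner ℝ (μ q) (x q - (y + w)) + α / 2 * ‖x q - (y + w)‖ ^ 2) =
      ∑ q, (inner ℝ (μ q) (x q - y) + α / 2 * ‖x q - y‖ ^ 2) -
        inner ℝ (∑ q, (μ q + α • (x q - y))) w + Fintype.card Q * (α / 2 * ‖w‖ ^ 2) := by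
  rw [sum_inner, ← nsmul_eq_mul, ← Finset.card_univ, ← Finset.sum_const, ← Finset.sum_sub_distrib,
    ← Finset.sum_add_distrib]
  refine Finset.sum_congr rfl fun q _ => ?_
  rw [← sub_sub, norm_sub_sq_real (x q - y), inner_sub_right, inner_add_left, real_inner_smul_left]
  ring

/-- The summands are the updated dual variables. If their sum g were nonzero, moving by sg would
gain s‖g‖² against a loss of order s². -/
lemma sum_eq_zero_of_isMinOn_augmented (μ x : Q → H) (α : ℝ) (y : H)
    (h : IsMinOn (fun y => ∑ q, (inner ℝ (μ q) (x q - y) + α / 2 * ‖x q - y‖ ^ 2)) Set.univ y) :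
    ∑ q, (μ q + α • (x q - y)) = 0 := by
  set g := ∑ q, (μ q + α • (x q - y)) with hg
  by_contra hne
  have hg0 : 0 < ‖g‖ ^ 2 := by positivity
  have key : ∀ s : ℝ, 0 < s → ‖g‖ ^ 2 ≤ s * (Fintype.card Q * (|α| / 2 * ‖g‖ ^ 2)) := by
    intro s hs
    have h1 := h (Set.mem_univ (y + s • g))
    simp only [Set.mem_ofPred_eq] at h1
    rw [sum_augmented_add, ← hg, real_inner_smul_right, real_inner_self_eq_norm_sq, norm_smul,
      mul_pow, Real.norm_eq_abs, sq_abs] at h1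
    have h2 : (Fintype.card Q : ℝ) * (α / 2 * (s ^ 2 * ‖g‖ ^ 2)) ≤
        Fintype.card Q * (|α| / 2 * (s ^ 2 * ‖g‖ ^ 2)) := by
      gcongr
      exact le_abs_self α
    refine le_of_mul_le_mul_left ?_ hs
    linarith
  have hl : Tendsto (fun s : ℝ => s * (Fintype.card Q * (|α| / 2 * ‖g‖ ^ 2))) (𝓝[>] 0)
      (𝓝 (0 * (Fintype.card Q * (|α| / 2 * ‖g‖ ^ 2)))) :=
    Tendsto.mono_left (Continuous.tendsto (by fun_prop) 0) nhdsWithin_le_nhds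
  rw [zero_mul] at hl
  have := ge_of_tendsto hl (b := ‖g‖ ^ 2) (by
    filter_upwards [self_mem_nhdsWithin] with s hs using key s hs)
  linarith

lemma exists_isMinOn_sum_augmented [Nonempty Q] (μ x : Q → H) {α : ℝ} (hα : 0 < α) :
    ∃ y, IsMinOn (fun y => ∑ q, (inner ℝ (μ q) (x q - y) + α / 2 * ‖x q - y‖ ^ 2)) Set.univ y := by
  have hc : (Fintype.card Q : ℝ) ≠ 0 := by positivity
  -- The mean of x + μ/α makes the linear term of the expansion vanish.
  refine ⟨(Fintype.card Q : ℝ)⁻¹ • ∑ q, (α⁻¹ • μ q + x q), fun w _ => ?_⟩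
  set y := (Fintype.card Q : ℝ)⁻¹ • ∑ q, (α⁻¹ • μ q + x q) with hy
  have h0 : ∑ q, (μ q + α • (x q - y)) = 0 := by
    have e : ∀ q, μ q + α • (x q - y) = α • (α⁻¹ • μ q + x q) - α • y := fun q => by
      rw [smul_add, smul_smul, mul_inv_cancel₀ hα.ne']; module
    rw [Finset.sum_congr rfl fun q _ => e q, Finset.sum_sub_distrib, ← Finset.smul_sum,
      Finset.sum_const, Finset.card_univ, ← Nat.cast_smul_eq_nsmul ℝ,
      smul_comm (Fintype.card Q : ℝ) α y, hy, smul_smul (Fintype.card Q : ℝ) _⁻¹,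
      mul_inv_cancel₀ hc, one_smul, sub_self]
  have h1 := sum_augmented_add μ x α y (w - y)
  rw [h0, inner_zero_left, add_sub_cancel] at h1
  simp only [Set.mem_ofPred_eq]
  rw [h1]
  have : 0 ≤ (Fintype.card Q : ℝ) * (α / 2 * ‖w - y‖ ^ 2) := by positivity
  linarith

end Average

/-! ### Positive semidefinite and positive definite matrices -/

section MatrixCone

variable {m n : Type*}

lemma posDef_of_posSemidef_sub [DecidableEq n] {A : Matrix n n ℝ} {ε : ℝ} (hε : 0 < ε)
    (h : (A - ε • 1).PosSemidef) : A.PosDef := by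
  have := (PosDef.one (n := n) (R := ℝ)).smul hε
  simpa using PosDef.posSemidef_add h this

lemma posDef_combo {A B : Matrix n n ℝ} (hA : A.PosSemidef) (hB : B.PosDef) {a b : ℝ} (ha : 0 ≤ a)
    (hb : 0 < b) : (a • A + b • B).PosDef :=
  PosDef.posSemidef_add (hA.smul ha) (hB.smul hb)

variable [Fintype m] [Fintype n]

lemma isClosed_posSemidef : IsClosed {A : Matrix n n ℝ | A.PosSemidef} := by
  have : {A : Matrix n n ℝ | A.PosSemidef} =
      {A | Aᴴ = A} ∩ ⋂ x : n → ℝ, {A | 0 ≤ star x ⬝ᵥ A *ᵥ x} := by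
    ext A
    simp [posSemidef_iff_dotProduct_mulVec, Matrix.IsHermitian]
  rw [this]
  refine (isClosed_eq continuous_id.matrix_conjTranspose continuous_id).inter
    (isClosed_iInter fun x => isClosed_le continuous_const ?_)
  exact continuous_const.dotProduct (continuous_id.matrix_mulVec continuous_const)

/-- Positive definiteness is an open condition among Hermitian matrices. -/
lemma eventually_posDef {X : Type*} [TopologicalSpace X] {f : X → Matrix n n ℝ} {x₀ : X}
    (hf : Continuous f) (hh : ∀ x, (f x).IsHermitian) (h₀ : (f x₀).PosDef) :
    ∀ᶠ x in 𝓝 x₀, (f x).PosDef := by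
  have hc : Continuous fun q : X × (n → ℝ) => q.2 ⬝ᵥ f q.1 *ᵥ q.2 :=
    continuous_snd.dotProduct ((hf.comp continuous_fst).matrix_mulVec continuous_snd)
  -- Compactness of the unit sphere gives one neighbourhood for all unit vectors; homogeneity covers
  -- the rest.
  have h1 : ∀ᶠ x in 𝓝 x₀, ∀ y ∈ Metric.sphere (0 : n → ℝ) 1, 0 < y ⬝ᵥ f x *ᵥ y := by
    refine (isCompact_sphere _ _).eventually_forall_of_forall_eventually fun y hy => ?_
    refine (hc.tendsto (x₀, y)).eventually (lt_mem_nhds ?_)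
    have hy0 : y ≠ 0 := by rintro rfl; simp at hy
    simpa using h₀.dotProduct_mulVec_pos hy0
  filter_upwards [h1] with x hx
  refine PosDef.of_dotProduct_mulVec_pos (hh x) fun y hy => ?_
  have hn : 0 < ‖y‖ := norm_pos_iff.2 hy
  have h2 := hx (‖y‖⁻¹ • y) (by simp [norm_smul, hn.ne'])
  rw [mulVec_smul, smul_dotProduct, dotProduct_smul, smul_smul, smul_eq_mul] at h2
  rw [star_trivial]
  exact pos_of_mul_pos_right h2 (by positivity)

lemma dotProduct_fromBlocks_diag (A : Matrix m m ℝ) (B : Matrix n n ℝ) (x : m ⊕ n → ℝ) :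
    x ⬝ᵥ fromBlocks A 0 0 B *ᵥ x =
      (x ∘ Sum.inl) ⬝ᵥ A *ᵥ (x ∘ Sum.inl) + (x ∘ Sum.inr) ⬝ᵥ B *ᵥ (x ∘ Sum.inr) := by
  rw [fromBlocks_mulVec]
  simp [dotProduct, Fintype.sum_sum_type]

lemma posSemidef_fromBlocks_diag {A : Matrix m m ℝ} {B : Matrix n n ℝ} :
    (fromBlocks A 0 0 B).PosSemidef ↔ A.PosSemidef ∧ B.PosSemidef := by
  refine ⟨fun h => ⟨h.submatrix Sum.inl, h.submatrix Sum.inr⟩, fun ⟨hA, hB⟩ => ?_⟩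
  refine PosSemidef.of_dotProduct_mulVec_nonneg
    (hA.1.fromBlocks (by simp) hB.1) fun x => ?_
  rw [star_trivial, dotProduct_fromBlocks_diag]
  exact add_nonneg (by simpa using hA.dotProduct_mulVec_nonneg (x ∘ Sum.inl))
    (by simpa using hB.dotProduct_mulVec_nonneg (x ∘ Sum.inr))

lemma posDef_fromBlocks_diag {A : Matrix m m ℝ} {B : Matrix n n ℝ} :
    (fromBlocks A 0 0 B).PosDef ↔ A.PosDef ∧ B.PosDef := by
  refine ⟨fun h => ⟨h.submatrix Sum.inl_injective, h.submatrix Sum.inr_injective⟩,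
    fun ⟨hA, hB⟩ => ?_⟩
  refine PosDef.of_dotProduct_mulVec_pos (hA.1.fromBlocks (by simp) hB.1) fun x hx => ?_
  rw [star_trivial, dotProduct_fromBlocks_diag]
  have h1 : 0 ≤ (x ∘ Sum.inl) ⬝ᵥ A *ᵥ (x ∘ Sum.inl) := by
    simpa using hA.posSemidef.dotProduct_mulVec_nonneg (x ∘ Sum.inl)
  have h2 : 0 ≤ (x ∘ Sum.inr) ⬝ᵥ B *ᵥ (x ∘ Sum.inr) := by
    simpa using hB.posSemidef.dotProduct_mulVec_nonneg (x ∘ Sum.inr)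
  by_cases hl : x ∘ Sum.inl = 0
  · have hr : x ∘ Sum.inr ≠ 0 := fun hr => hx (by
      funext k
      rcases k with k | k
      · exact congrFun hl k
      · exact congrFun hr k)
    have := hB.dotProduct_mulVec_pos hr
    rw [star_trivial] at this
    linarith
  · have := hA.dotProduct_mulVec_pos hl
    rw [star_trivial] at this
    linarith

end MatrixCone

/-! ### Closedness of cones with two generators -/

section PlanarCone

variable {E : Type*} [AddCommGroup E] [Module ℝ E] [TopologicalSpace E]
  [IsTopologicalAddGroup E] [ContinuousSMul ℝ E] [T2Space E]

lemma isClosed_of_eq_image_smul {s : Set E} {t : Set ℝ} (v : E) (ht : IsClosed t)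
    (hs : s = (fun r : ℝ => r • v) '' t) : IsClosed s :=
  hs ▸ isClosedMap_smul_left v t ht

/-- A shifted finitely generated cone with two generators is closed. -/
lemma isClosed_planarCone (a b : E) (ε : ℝ) :
    IsClosed {x : E | ∃ τ l : ℝ, ε ≤ τ ∧ 0 ≤ l ∧ x = τ • a + l • b} := by
  by_cases hli : LinearIndependent ℝ ![a, b]
  · let f : (Fin 2 → ℝ) →ₗ[ℝ] E := Fintype.linearCombination ℝ ![a, b]
    have hf : Topology.IsClosedEmbedding f :=
      LinearMap.isClosedEmbedding_of_injective
        (LinearMap.ker_eq_bot.2 hli.fintypeLinearCombination_injective)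
    have h1 : IsClosed {r : Fin 2 → ℝ | ε ≤ r 0 ∧ 0 ≤ r 1} :=
      (isClosed_le continuous_const (continuous_apply 0)).inter
        (isClosed_le continuous_const (continuous_apply 1))
    convert hf.isClosedMap _ h1 using 1
    ext x
    constructor
    · rintro ⟨τ, l, h1, h2, rfl⟩
      exact ⟨![τ, l], ⟨h1, h2⟩, by simp [f, Fintype.linearCombination_apply]⟩
    · rintro ⟨r, ⟨h1, h2⟩, rfl⟩
      exact ⟨r 0, r 1, h1, h2, by simp [f, Fintype.linearCombination_apply]⟩
  by_cases hb : b = 0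
  · subst hb
    refine isClosed_of_eq_image_smul a (isClosed_Ici (a := ε)) ?_
    ext x
    constructor
    · rintro ⟨τ, l, h1, h2, rfl⟩
      exact ⟨τ, h1, by simp⟩
    · rintro ⟨τ, h1, rfl⟩
      exact ⟨τ, 0, h1, le_rfl, by simp⟩
  obtain ⟨r, rfl⟩ : ∃ r : ℝ, r • b = a := by
    have h2 := hli
    rw [LinearIndependent.pair_symm_iff, LinearIndependent.pair_iff' hb] at h2
    push Not at h2
    exact h2
  -- For dependent generators with b ≠ 0 the set is a half-line along b if r ≥ 0, and the whole line
  -- if r < 0.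
  rcases le_or_gt 0 r with hr | hr
  · refine isClosed_of_eq_image_smul b (isClosed_Ici (a := ε * r)) ?_
    ext x
    constructor
    · rintro ⟨τ, l, h1, h2, rfl⟩
      refine ⟨τ * r + l, ?_, by module⟩
      simp only [Set.mem_Ici]
      nlinarith
    · rintro ⟨q, h1, rfl⟩
      exact ⟨ε, q - ε * r, le_rfl, by simpa using h1, by module⟩
  · refine isClosed_of_eq_image_smul b isClosed_univ ?_
    ext x
    constructor
    · rintro ⟨τ, l, h1, h2, rfl⟩
      exact ⟨τ * r + l, trivial, by module⟩
    · rintro ⟨q, -, rfl⟩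
      -- As r < 0, any τ ≥ q / r leaves a nonnegative coefficient for b.
      refine ⟨max ε (q / r), q - max ε (q / r) * r, le_max_left _ _, ?_, by module⟩
      have := mul_le_mul_of_nonpos_right (le_max_right ε (q / r)) hr.le
      rw [div_mul_cancel₀ _ hr.ne] at this
      linarith

end PlanarCone

/-- For the block matrices below, affine combinations are easier to check than continuity.
Additivity of g - g 0 comes from the midpoint of 2x and 2y. -/
lemma continuous_of_affine {E F : Type*} [AddCommGroup E] [Module ℝ E] [TopologicalSpace E]
    [IsTopologicalAddGroup E] [ContinuousSMul ℝ E] [T2Space E] [FiniteDimensional ℝ E]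
    [AddCommGroup F] [Module ℝ F] [TopologicalSpace F] [IsTopologicalAddGroup F]
    [ContinuousSMul ℝ F] (g : E → F)
    (hg : ∀ (a b : ℝ) (x y : E), a + b = 1 → g (a • x + b • y) = a • g x + b • g y) :
    Continuous g := by
  have hs : ∀ (r : ℝ) (x : E), g (r • x) - g 0 = r • (g x - g 0) := fun r x => by
    have := hg r (1 - r) x 0 (by ring)
    rw [smul_zero, add_zero] at this
    rw [this]; module
  let f : E →ₗ[ℝ] F :=
    { toFun := fun x => g x - g 0
      map_add' := fun x y => by
        have h1 := hg (1 / 2) (1 / 2) ((2 : ℝ) • x) ((2 : ℝ) • y) (by norm_num)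
        rw [smul_smul, smul_smul, show (1 / 2 * 2 : ℝ) = 1 by norm_num, one_smul, one_smul,
          sub_eq_iff_eq_add.1 (hs 2 x), sub_eq_iff_eq_add.1 (hs 2 y)] at h1
        rw [h1]; module
      map_smul' := hs }
  have hf : Continuous f := LinearMap.continuous_of_finiteDimensional f
  have : g = fun x => f x + g 0 := by funext x; simp [f]
  rw [this]
  exact hf.add continuous_const

/-! ### Affinity and symmetry of the network operators -/

namespace Network

variable {M : ℕ} (w : Network M) (i : Fin M)

lemma EN_combo (a b : ℝ) (E E' : ∀ j : {j // j ∈ w.nbhd i}, Matrix (w.Idx j.1) (w.Idx j.1) ℝ) :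
    w.EN i (a • E + b • E') = a • w.EN i E + b • w.EN i E' := by
  simp only [EN, blockDiagonal'_add, blockDiagonal'_smul]

lemma Ebar_combo (a b : ℝ) (E E' : Matrix (w.Idx i) (w.Idx i) ℝ) :
    w.Ebar i (a • E + b • E') = a • w.Ebar i E + b • w.Ebar i E' := by
  simp only [Ebar, Matrix.mul_add, Matrix.add_mul, Matrix.mul_smul, Matrix.smul_mul]

lemma coupling_combo (a b : ℝ)
    (S S' : ∀ j : {j // j ∈ w.nbhd i}, Matrix (w.NIdx j.1) (w.NIdx j.1) ℝ) :
    w.coupling i (a • S + b • S') = a • w.coupling i S + b • w.coupling i S' := by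
  simp only [coupling, Pi.add_apply, Pi.smul_apply, Matrix.mul_add, Matrix.add_mul, Matrix.mul_smul,
    Matrix.smul_mul, Finset.sum_add_distrib, Finset.smul_sum]

variable {i}

lemma EN_isHermitian {E : ∀ j : {j // j ∈ w.nbhd i}, Matrix (w.Idx j.1) (w.Idx j.1) ℝ}
    (h : ∀ j, (E j).IsHermitian) : (w.EN i E).IsHermitian := by
  simp only [IsHermitian, EN, blockDiagonal'_conjTranspose]
  congr 1
  funext j
  exact h j

lemma isHermitian_of_EN {E : ∀ j : {j // j ∈ w.nbhd i}, Matrix (w.Idx j.1) (w.Idx j.1) ℝ}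
    (h : (w.EN i E).IsHermitian) (j : {j // j ∈ w.nbhd i}) : (E j).IsHermitian := by
  have := h.submatrix (fun a : w.Idx j.1 => (⟨j, a⟩ : w.NIdx i))
  convert this using 1
  ext a b
  simp [EN, blockDiagonal'_apply]

lemma Ebar_isHermitian {E : Matrix (w.Idx i) (w.Idx i) ℝ} (h : E.IsHermitian) :
    (w.Ebar i E).IsHermitian := by
  have h1 : w.Ebar i E = (w.W i * (w.T i)ᵀ) * E * (w.W i * (w.T i)ᵀ)ᴴ := by
    simp only [Ebar, conjTranspose_eq_transpose_of_trivial, transpose_mul, transpose_transpose,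
      Matrix.mul_assoc]
  rw [h1]
  exact isHermitian_mul_mul_conjTranspose _ h

lemma coupling_term (j : Fin M) (S : Matrix (w.NIdx j) (w.NIdx j) ℝ) :
    w.T i * (w.W j)ᵀ * S * w.W j * (w.T i)ᵀ =
      (w.T i * (w.W j)ᵀ) * S * (w.T i * (w.W j)ᵀ)ᴴ := by
  simp only [conjTranspose_eq_transpose_of_trivial, transpose_mul, transpose_transpose,
    Matrix.mul_assoc]

lemma coupling_isHermitian {S : ∀ j : {j // j ∈ w.nbhd i}, Matrix (w.NIdx j.1) (w.NIdx j.1) ℝ}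
    (h : ∀ j, (S j).IsHermitian) : (w.coupling i S).IsHermitian := by
  simp only [coupling, coupling_term]
  exact isSelfAdjoint_sum _ fun j _ => isHermitian_mul_mul_conjTranspose _ (h j)

/-- As i lies in its own neighbourhood, the columns of W_i T_iᵀ are the unit vectors of block i. -/
lemma T_mul_W_transpose_mul :
    w.T i * (w.W i)ᵀ * (1 : Matrix (w.NIdx i) (w.NIdx i) ℝ) * w.W i * (w.T i)ᵀ = 1 := by
  have h1 : ∀ (k : w.NIdx i) (b : w.Idx i), (w.W i * (w.T i)ᵀ) k b =
      if k = ⟨⟨i, w.self_mem_nbhd i⟩, b⟩ then 1 else 0 := by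
    rintro ⟨⟨j, hj⟩, k⟩ b
    simp only [W, T, Matrix.mul_apply, transpose_apply, of_apply, ite_mul, one_mul, zero_mul,
      Finset.sum_ite_eq', Finset.mem_univ, if_true]
    by_cases hji : j = i
    · subst hji
      simp
    · rw [if_neg, if_neg]
      · intro h; exact hji (by simpa using congrArg (fun q => q.1.1) h)
      · intro h; exact hji (congrArg Sigma.fst h)
  have h2 : w.T i * (w.W i)ᵀ = (w.W i * (w.T i)ᵀ)ᵀ := by simp
  rw [Matrix.mul_one, Matrix.mul_assoc, h2]
  ext a b
  simp only [Matrix.mul_apply, transpose_apply, h1, ite_mul, one_mul, zero_mul,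
      Finset.sum_ite_eq', Finset.mem_univ, if_true]
  simp [one_apply]

/-- The summand of i is the identity and the others are positive semidefinite. So lowering every S
by a positive multiple of the identity makes the coupling inequality strict. -/
lemma coupling_one_posDef :
    (w.coupling i fun _ => 1).PosDef := by
  classical
  rw [coupling, Finset.univ_eq_attach,
    ← Finset.add_sum_erase _ _ (Finset.mem_attach _ ⟨i, w.self_mem_nbhd i⟩)]
  refine PosDef.add_posSemidef ?_ (posSemidef_sum _ fun j _ => ?_)
  · rw [T_mul_W_transpose_mul]
    exact PosDef.one
  · rw [coupling_term]
    exact PosSemidef.one.mul_mul_conjTranspose_same _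

end Network

/-! ### The inequalities of one agent as a single affine matrix inequality -/

namespace GrayBox

variable {M N : ℕ} (d : GrayBox M N)

/-- The variables that enter the matrix inequalities of agent `i`. -/
abbrev LocVars (i : Fin M) : Type :=
  Matrix (Fin (d.nd i)) (Fin (d.nd i)) ℝ ×
  (∀ j : {j // j ∈ d.nbhd i}, Matrix (d.Idx j.1) (d.Idx j.1) ℝ) ×
  Matrix (d.Idx i ⊕ Fin (d.nz i)) (d.Idx i ⊕ Fin (d.nz i)) ℝ ×
  (∀ j : {j // j ∈ d.nbhd i}, Matrix (d.NIdx j.1) (d.NIdx j.1) ℝ) ×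
  Matrix (d.NIdx i) (d.NIdx i) ℝ ×
  Matrix (Fin (d.m i)) (d.NIdx i) ℝ

namespace LocVars

variable {d} {i : Fin M} (x : d.LocVars i)

abbrev Φ := x.1
abbrev E := x.2.1
abbrev P := x.2.2.1
abbrev S := x.2.2.2.1
abbrev F := x.2.2.2.2.1
abbrev Y := x.2.2.2.2.2

end LocVars

variable {d} {i : Fin M}

/-- The same two generators serve every range of τ, so margins can be compared within one family. -/
lemma exists_multCom_eq (d : GrayBox M N) (i : Fin M) :
    ∃ a b, ∀ range, d.multCom i range =
      {P | ∃ τ l : ℝ, τ ∈ range ∧ 0 ≤ l ∧ P = τ • a + l • b} := by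
  refine ⟨(d.mirror i)ᵀ * (fromBlocks (-d.dataZ i) 0 (d.dataM i) (d.Bd i) *
    fromBlocks (d.Qd i) (d.Sd i) (d.Sd i)ᵀ (d.Rd i) *
    (fromBlocks (-d.dataZ i) 0 (d.dataM i) (d.Bd i))ᵀ) * d.mirror i,
    (d.mirror i)ᵀ * (d.priorFactor i * d.priorCore i * (d.priorFactor i)ᵀ) * d.mirror i,
    fun range => ?_⟩
  ext P
  constructor
  · rintro ⟨_, ⟨_, ⟨τ, hτ, rfl⟩, rfl⟩, _, ⟨l, hl, rfl⟩, rfl⟩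
    refine ⟨τ, l, hτ, hl, ?_⟩
    simp only [Matrix.mul_smul, Matrix.smul_mul, Matrix.mul_add, Matrix.add_mul]
  · rintro ⟨τ, l, hτ, hl, rfl⟩
    refine ⟨_, ⟨_, ⟨τ, hτ, rfl⟩, rfl⟩, _, ⟨l, hl, rfl⟩, ?_⟩
    simp only [Matrix.mul_smul, Matrix.smul_mul, Matrix.mul_add, Matrix.add_mul]

/-- A linear image of a closed cone need not be closed; having only two generators saves it here. -/
lemma isClosed_multCom (ε : ℝ) : IsClosed (d.multCom i (Set.Ici ε)) := by
  obtain ⟨a, b, h⟩ := d.exists_multCom_eq i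
  rw [h]
  exact isClosed_planarCone a b ε

lemma convex_multCom {range : Set ℝ} (hr : Convex ℝ range) : Convex ℝ (d.multCom i range) := by
  obtain ⟨A, B, h⟩ := d.exists_multCom_eq i
  rw [h]
  rintro _ ⟨τ, l, hτ, hl, rfl⟩ _ ⟨τ', l', hτ', hl', rfl⟩ a b ha hb hab
  exact ⟨a • τ + b • τ', a * l + b * l', hr hτ hτ' ha hb hab, by positivity, by
    simp only [smul_eq_mul]; module⟩

lemma multCom_mono {r r' : Set ℝ} (h : r ⊆ r') : d.multCom i r ⊆ d.multCom i r' := by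
  rintro P ⟨P₁, ⟨Pd, ⟨τ, hτ, h1⟩, h2⟩, P₂, h3, h4⟩
  exact ⟨P₁, ⟨Pd, ⟨τ, h hτ, h1⟩, h2⟩, P₂, h3, h4⟩

lemma combo_multCom {ε : ℝ} {P P' : Matrix (d.Idx i ⊕ Fin (d.nz i)) (d.Idx i ⊕ Fin (d.nz i)) ℝ}
    (hP : P ∈ d.multCom i (Set.Ici ε)) (hP' : P' ∈ d.multCom i (Set.Ioi ε)) {a b : ℝ} (ha : 0 ≤ a)
    (hb : 0 < b) (hab : a + b = 1) : a • P + b • P' ∈ d.multCom i (Set.Ioi ε) := by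
  obtain ⟨A, B, h⟩ := d.exists_multCom_eq i
  rw [h] at *
  obtain ⟨τ, l, hτ, hl, rfl⟩ := hP
  obtain ⟨τ', l', hτ', hl', rfl⟩ := hP'
  refine ⟨a * τ + b * τ', a * l + b * l', ?_, by positivity, by module⟩
  simp only [Set.mem_Ici, Set.mem_Ioi] at *
  have h1 := mul_le_mul_of_nonneg_left hτ ha
  have h2 := mul_lt_mul_of_pos_left hτ' hb
  have : a * ε + b * ε = ε := by rw [← add_mul, hab, one_mul]
  linarith

lemma perfMatrix_combo {a b : ℝ} (hab : a + b = 1) (Φ Φ' : Matrix (Fin (d.nd i)) (Fin (d.nd i)) ℝ)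
    (E E' : Matrix (d.Idx i) (d.Idx i) ℝ) :
    d.perfMatrix i (a • Φ + b • Φ') (a • E + b • E') =
      a • d.perfMatrix i Φ E + b • d.perfMatrix i Φ' E' := by
  simp only [perfMatrix, fromBlocks_smul, fromBlocks_add, ← add_smul, hab, one_smul]

lemma stabMatrix_combo {a b : ℝ} (hab : a + b = 1)
    (E E' : ∀ j : {j // j ∈ d.nbhd i}, Matrix (d.Idx j.1) (d.Idx j.1) ℝ)
    (P P' : Matrix (d.Idx i ⊕ Fin (d.nz i)) (d.Idx i ⊕ Fin (d.nz i)) ℝ)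
    (F F' : Matrix (d.NIdx i) (d.NIdx i) ℝ) (Y Y' : Matrix (Fin (d.m i)) (d.NIdx i) ℝ) :
    d.stabMatrix i (a • E + b • E') (a • P + b • P') (a • F + b • F') (a • Y + b • Y') =
      a • d.stabMatrix i E P F Y + b • d.stabMatrix i E' P' F' Y' := by
  have hL : fromRows (d.A' i * d.EN i (a • E + b • E') + d.B' i * (a • Y + b • Y'))
      (d.Cz i * d.EN i (a • E + b • E') + d.Dz i * (a • Y + b • Y')) =
      a • fromRows (d.A' i * d.EN i E + d.B' i * Y) (d.Cz i * d.EN i E + d.Dz i * Y) +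
      b • fromRows (d.A' i * d.EN i E' + d.B' i * Y') (d.Cz i * d.EN i E' + d.Dz i * Y') := by
    rw [Network.EN_combo]
    ext (k | k) l <;>
    simp only [fromRows_apply_inl, fromRows_apply_inr, Matrix.mul_add, Matrix.mul_smul,
      Matrix.add_apply, Matrix.smul_apply, smul_eq_mul] <;> ring
  have hK : d.Cy i * d.EN i (a • E + b • E') + d.Dy i * (a • Y + b • Y') =
      a • (d.Cy i * d.EN i E + d.Dy i * Y) + b • (d.Cy i * d.EN i E' + d.Dy i * Y') := by
    rw [Network.EN_combo, Matrix.mul_add, Matrix.mul_add, Matrix.mul_smul, Matrix.mul_smul,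
      Matrix.mul_smul, Matrix.mul_smul]
    module
  simp only [stabMatrix, hL, hK, Pi.add_apply, Pi.smul_apply, Network.Ebar_combo]
  rw [fromBlocks_smul a, fromBlocks_smul b, fromBlocks_add]
  congr 1
  · ext (k | k) (l | l)
    · simp
      ring
    · simp
    · simp
    · simp

  · ext k (l | l) <;> simp
  · ext (k | k) l <;> simp
  · rw [fromBlocks_smul a, fromBlocks_smul b, fromBlocks_add]
    congr 1
    · module
    · rw [smul_neg, smul_neg, ← neg_add, ← add_smul, hab, one_smul]

/-- Index of the block-diagonal collection of all matrix inequalities of agent `i`. -/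
abbrev LmiIdx (d : GrayBox M N) (i : Fin M) : Type :=
  d.Idx i ⊕ d.NIdx i ⊕ Fin (d.nd i) ⊕ (Fin (d.nd i) ⊕ d.Idx i) ⊕
    ((d.Idx i ⊕ Fin (d.nz i)) ⊕ d.NIdx i ⊕ Fin (d.p i)) ⊕ d.NIdx i ⊕ d.Idx i

/-- All matrix inequalities of agent `i`, with margin `ε`, as one block-diagonal matrix. -/
def lmi (ε : ℝ) (x : d.LocVars i) : Matrix (d.LmiIdx i) (d.LmiIdx i) ℝ :=
  fromBlocks (x.E ⟨i, d.self_mem_nbhd i⟩ - ε • 1) 0 0 <|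
  fromBlocks (d.EN i x.E - ε • 1) 0 0 <|
  fromBlocks (x.Φ - ε • 1) 0 0 <|
  fromBlocks (d.perfMatrix i x.Φ (x.E ⟨i, d.self_mem_nbhd i⟩) - ε • 1) 0 0 <|
  fromBlocks (-d.stabMatrix i x.E x.P x.F x.Y - ε • 1) 0 0 <|
  fromBlocks (x.S ⟨i, d.self_mem_nbhd i⟩ - x.F) 0 0 (-d.coupling i x.S)

/-- Varying ε together with x yields joint continuity. The constant blocks force a + b = 1. -/
lemma lmi_combo {a b : ℝ} (hab : a + b = 1) (ε ε' : ℝ) (x x' : d.LocVars i) :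
    lmi (a * ε + b * ε') (a • x + b • x') = a • lmi ε x + b • lmi ε' x' := by
  obtain ⟨Φ, E, P, S, F, Y⟩ := x
  obtain ⟨Φ', E', P', S', F', Y'⟩ := x'
  simp only [lmi, Prod.smul_mk, Prod.mk_add_mk, Network.EN_combo,
    perfMatrix_combo hab, stabMatrix_combo hab, Network.coupling_combo, Pi.add_apply,
    Pi.smul_apply, LocVars.Φ, LocVars.E, LocVars.P, LocVars.S, LocVars.F, LocVars.Y]
  simp only [fromBlocks_smul, fromBlocks_add, smul_zero, add_zero]
  congr 1
  · module
  congr 1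
  · module
  congr 1
  · module
  congr 1
  · module
  congr 1
  · module
  congr 1
  · module
  · module

lemma continuous_lmi : Continuous fun q : ℝ × d.LocVars i => lmi q.1 q.2 :=
  continuous_of_affine _ fun _ _ q q' hab => lmi_combo hab q.1 q'.1 q.2 q'.2

/-- The variables of an agent that enter symmetrically are symmetric matrices. -/
structure IsSymmVars (x : d.LocVars i) : Prop where
  Φ : x.Φ.IsHermitian
  E : ∀ j, (x.E j).IsHermitian
  P : x.P.IsHermitian
  S : ∀ j, (x.S j).IsHermitian
  F : x.F.IsHermitian

lemma stabMatrix_isHermitian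
    {E : ∀ j : {j // j ∈ d.nbhd i}, Matrix (d.Idx j.1) (d.Idx j.1) ℝ}
    {P : Matrix (d.Idx i ⊕ Fin (d.nz i)) (d.Idx i ⊕ Fin (d.nz i)) ℝ}
    {F : Matrix (d.NIdx i) (d.NIdx i) ℝ} {Y : Matrix (Fin (d.m i)) (d.NIdx i) ℝ}
    (hE : ∀ j, (E j).IsHermitian) (hP : P.IsHermitian) (hF : F.IsHermitian) :
    (d.stabMatrix i E P F Y).IsHermitian := by
  have h1 : (fromBlocks (-E ⟨i, d.self_mem_nbhd i⟩) 0 0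
      (0 : Matrix (Fin (d.nz i)) (Fin (d.nz i)) ℝ)).IsHermitian :=
    (hE _).neg.fromBlocks (by simp) (by simp)
  have h2 : ∀ L : Matrix (d.Idx i ⊕ Fin (d.nz i)) (d.NIdx i) ℝ,
      (fromCols L (0 : Matrix _ (Fin (d.p i)) ℝ))ᴴ = fromRows Lᵀ 0 := fun L => by
    rw [conjTranspose_eq_transpose_of_trivial, transpose_fromCols, transpose_zero]
  have h3 := fun K : Matrix (Fin (d.p i)) (d.NIdx i) ℝ =>
    IsHermitian.fromBlocks ((Network.Ebar_isHermitian _ (hE ⟨i, d.self_mem_nbhd i⟩)).neg.sub hF)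
      (show Kᵀᴴ = K by simp) (isHermitian_one (n := Fin (d.p i)) (α := ℝ)).neg
  exact IsHermitian.fromBlocks (hP.add h1) (h2 _) (h3 _)


lemma lmi_isHermitian (ε : ℝ) {x : d.LocVars i} (h : IsSymmVars x) : (lmi ε x).IsHermitian := by
  have he : ∀ {n : Type} [DecidableEq n], (ε • (1 : Matrix n n ℝ)).IsHermitian := fun {n} _ => by
    simp [IsHermitian]
  have hperf : (d.perfMatrix i x.Φ (x.E ⟨i, d.self_mem_nbhd i⟩)).IsHermitian :=
    h.Φ.fromBlocks (by simp) (h.E _)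
  have hstab : (d.stabMatrix i x.E x.P x.F x.Y).IsHermitian :=
    stabMatrix_isHermitian h.E h.P h.F
  refine IsHermitian.fromBlocks ((h.E _).sub he) (by simp) ?_
  refine IsHermitian.fromBlocks ((Network.EN_isHermitian _ h.E).sub he) (by simp) ?_
  refine IsHermitian.fromBlocks (h.Φ.sub he) (by simp) ?_
  refine IsHermitian.fromBlocks (hperf.sub he) (by simp) ?_
  refine IsHermitian.fromBlocks (hstab.neg.sub he) (by simp) ?_
  exact IsHermitian.fromBlocks ((h.S _).sub h.F) (by simp) (Network.coupling_isHermitian _ h.S).neg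

/-- The side constraint on the block structure of the variables `S_j`. -/
def SBlock (x : d.LocVars i) : Prop := ∀ j, (x.S j).IsSymm ∧ d.IsBlockDiag j.1 (x.S j)

lemma marginLMI_iff {ε : ℝ} (x : d.LocVars i) :
    d.MarginLMI ε i x.Φ x.E x.P x.S x.F x.Y ↔
      (lmi ε x).PosSemidef ∧ x.P ∈ d.multCom i (Set.Ici ε) ∧ SBlock x := by
  simp only [lmi, posSemidef_fromBlocks_diag]
  constructor
  · intro h
    exact ⟨⟨h.E_pos, h.EN_pos, h.Φ_pos, h.perf, h.stab, h.F_le_S, h.coupling⟩, h.P_mem, h.S_block⟩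
  · rintro ⟨⟨h1, h2, h3, h4, h5, h6, h7⟩, h8, h9⟩
    exact ⟨h1, h2, h3, h8, h9, h4, h5, h6, h7⟩

lemma strictLMI_of_posDef {ε : ℝ} (hε : 0 ≤ ε) {x : d.LocVars i} (h : (lmi ε x).PosDef)
    (hP : x.P ∈ d.multCom i (Set.Ioi ε)) (hS : SBlock x) :
    d.StrictLMI i x.Φ x.E x.P x.S x.F x.Y := by
  simp only [lmi, posDef_fromBlocks_diag] at h
  obtain ⟨h1, h2, h3, h4, h5, h6, h7⟩ := h
  have key : ∀ {n : Type} [Fintype n] [DecidableEq n] {A : Matrix n n ℝ},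
      (A - ε • 1).PosDef → A.PosDef := fun
 {n} _ _ {A} hA => by
      simpa using hA.add_posSemidef ((PosSemidef.one (n := n) (R := ℝ)).smul hε)
  exact ⟨key h1, key h2, key h3, multCom_mono (Set.Ioi_subset_Ioi hε) hP, hS, key h4, key h5,
    h6.posSemidef, h7.posSemidef⟩

lemma strictLMI_of_margin {ε : ℝ} (hε : 0 < ε) {x : d.LocVars i}
    (h : d.MarginLMI ε i x.Φ x.E x.P x.S x.F x.Y) :
    d.StrictLMI i x.Φ x.E x.P x.S x.F x.Y :=
  ⟨posDef_of_posSemidef_sub hε h.E_pos, posDef_of_posSemidef_sub hε h.EN_pos,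
    posDef_of_posSemidef_sub hε h.Φ_pos, multCom_mono (Set.Ici_subset_Ioi.2 hε) h.P_mem,
    h.S_block, posDef_of_posSemidef_sub hε h.perf, posDef_of_posSemidef_sub hε h.stab,
    h.F_le_S, h.coupling⟩

/-- Symmetry is hidden in the inequalities: P is a corner of the stability matrix up to E, and F
differs from S by a symmetric matrix. It is needed because positive definiteness is open only among
Hermitian matrices. -/
lemma isSymmVars_of_strictLMI {x : d.LocVars i}
    (h : d.StrictLMI i x.Φ x.E x.P x.S x.F x.Y) : IsSymmVars x where
  Φ := h.Φ_pos.1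
  E := Network.isHermitian_of_EN _ h.EN_pos.1
  S j := by simpa [IsHermitian, IsSymm] using (h.S_block j).1
  P := by
    have h1 : (x.P + fromBlocks (-x.E ⟨i, d.self_mem_nbhd i⟩) 0 0 0).IsHermitian := by
      have h2 : (d.stabMatrix i x.E x.P x.F x.Y).IsHermitian := by simpa using h.stab.1.neg
      exact h2.submatrix Sum.inl
    have h2 : (fromBlocks (-x.E ⟨i, d.self_mem_nbhd i⟩) 0 0
        (0 : Matrix (Fin (d.nz i)) (Fin (d.nz i)) ℝ)).IsHermitian :=
      h.E_pos.1.neg.fromBlocks (by simp) (by simp)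
    simpa using h1.sub h2
  F := by
    have h1 : (x.S ⟨i, d.self_mem_nbhd i⟩).IsHermitian := by
      simpa [IsHermitian, IsSymm] using (h.S_block _).1
    simpa using h1.sub h.F_le_S.1

end GrayBox

/-! ### Slater points and local constraint sets -/

namespace GrayBox

variable {M N : ℕ} {d : GrayBox M N} {i : Fin M}

/-- The variables of the global problem that enter the matrix inequalities of agent `i`. -/
def loc (X : d.GlobalVars) (i : Fin M) : d.LocVars i :=
  ((X i).Φ, fun j => (X j.1).E, (X i).P, fun j => (X j.1).S, (X i).F, (X i).Y)

lemma loc_combo (a b : ℝ) (X X' : d.GlobalVars) (i : Fin M) :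
    loc (a • X + b • X') i = a • loc X i + b • loc X' i := rfl

lemma SBlock.combo {x x' : d.LocVars i} (h : SBlock x) (h' : SBlock x') (a b : ℝ) :
    SBlock (a • x + b • x') := fun j => by
  refine ⟨?_, fun k l hkl => ?_⟩
  · exact ((h j).1.smul a).add ((h' j).1.smul b)
  · have e : (a • x + b • x').S j k l = a * x.S j k l + b * x'.S j k l := rfl
    rw [e, (h j).2 k l hkl, (h' j).2 k l hkl]
    simp

lemma cost_combo (a b : ℝ) (X X' : d.GlobalVars) :
    d.cost (a • X + b • X') = a * d.cost X + b * d.cost X' := by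
  simp only [cost, Finset.mul_sum, ← Finset.sum_add_distrib]
  refine Finset.sum_congr rfl fun i _ => ?_
  change (a • (X i).Φ + b • (X' i).Φ).trace = _
  rw [trace_add, trace_smul, trace_smul, smul_eq_mul, smul_eq_mul]

/-- The matrix inequalities hold with all inequalities, also the two nonstrict ones, strict beyond
the margin `ε`. -/
def IsSlater (ε : ℝ) (X : d.GlobalVars) : Prop :=
  ∀ i, (lmi ε (loc X i)).PosDef ∧ (X i).P ∈ d.multCom i (Set.Ioi ε) ∧ SBlock (loc X i)

lemma IsSlater.strict {ε : ℝ} (hε : 0 ≤ ε) {X : d.GlobalVars} (h : IsSlater ε X) :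
    X ∈ d.strictFeasible := fun i =>
  strictLMI_of_posDef hε (h i).1 (h i).2.1 (h i).2.2

lemma mem_feasible_iff {ε : ℝ} {X : d.GlobalVars} :
    X ∈ d.feasible ε ↔ ∀ i, (lmi ε (loc X i)).PosSemidef ∧
      (X i).P ∈ d.multCom i (Set.Ici ε) ∧ SBlock (loc X i) :=
  forall_congr' fun i => marginLMI_iff (loc X i)

lemma IsSlater.feasible {ε : ℝ} {X : d.GlobalVars} (h : IsSlater ε X) : X ∈ d.feasible ε :=
  mem_feasible_iff.2 fun i => ⟨(h i).1.posSemidef, multCom_mono Set.Ioi_subset_Ici_self (h i).2.1,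
    (h i).2.2⟩

lemma IsSlater.combo {ε : ℝ} {X X' : d.GlobalVars} (h : X ∈ d.feasible ε) (h' : IsSlater ε X')
    {a b : ℝ} (ha : 0 ≤ a) (hb : 0 < b) (hab : a + b = 1) : IsSlater ε (a • X + b • X') := by
  rw [mem_feasible_iff] at h
  intro i
  rw [loc_combo]
  refine ⟨?_, combo_multCom (h i).2.1 (h' i).2.1 ha hb hab, (h i).2.2.combo (h' i).2.2 a b⟩
  have := lmi_combo hab ε ε (loc X i) (loc X' i)
  rw [← add_mul, hab, one_mul] at this
  rw [this]
  exact posDef_combo (h i).1 (h' i).1 ha hb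

/-- A strictly feasible point can be moved, at the same cost, to the interior also of the two
nonstrict inequalities. -/
lemma exists_isSlater {X : d.GlobalVars} (hX : X ∈ d.strictFeasible) :
    ∃ X' : d.GlobalVars, d.cost X' = d.cost X ∧ IsSlater 0 X' := by
  have hsym : ∀ i, IsSymmVars (loc X i) := fun i => isSymmVars_of_strictLMI (hX i)
  -- Lowering S by κ and F by 2κ adds κ to S - F and makes the coupling strict; the stability
  -- inequality is already strict and survives small κ.
  let G : ℝ → d.GlobalVars := fun κ i =>
    ((X i).Φ, (X i).E, (X i).P, (X i).S - κ • 1, (X i).F - (2 * κ) • 1, (X i).Y)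
  have hone : ∀ {n : Type} [DecidableEq n] (κ : ℝ), (κ • (1 : Matrix n n ℝ)).IsHermitian :=
    fun {n} _ κ => by simp [IsHermitian]
  have hev : ∀ᶠ κ in 𝓝 (0 : ℝ), ∀ i, (-d.stabMatrix i (loc X i).E (X i).P
      ((X i).F - (2 * κ) • 1) (X i).Y).PosDef := by
    rw [eventually_all]
    intro i
    have hc : Continuous fun κ : ℝ => -d.stabMatrix i (loc X i).E (X i).P
        ((X i).F - (2 * κ) • 1) (X i).Y := by
      refine Continuous.neg (continuous_of_affine _ fun a b κ κ' hab => ?_)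
      have := stabMatrix_combo hab (loc X i).E (loc X i).E (X i).P (X i).P
        ((X i).F - (2 * κ) • 1) ((X i).F - (2 * κ') • 1) (X i).Y (X i).Y
      rw [← add_smul, ← add_smul, ← add_smul, hab, one_smul, one_smul, one_smul] at this
      rw [← this]
      congr 1
      rw [← sub_eq_zero]
      have e : (X i).F = (a + b) • (X i).F := by rw [hab, one_smul]
      nth_rewrite 1 [e]
      simp only [smul_eq_mul]
      module
    refine eventually_posDef hc (fun κ => ?_) (by simpa [loc] using (hX i).stab)
    exact (stabMatrix_isHermitian (hsym i).E (hsym i).P ((hsym i).F.sub (hone _))).neg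
  obtain ⟨κ, hκ, hκ0⟩ := ((hev.filter_mono nhdsWithin_le_nhds).and
    (self_mem_nhdsWithin (s := Set.Ioi (0 : ℝ)))).exists
  have hκ0 : 0 < κ := hκ0
  refine ⟨G κ, rfl, fun i => ⟨?_, (hX i).P_mem, fun j => ⟨?_, fun k l hkl => ?_⟩⟩⟩
  · simp only [lmi, posDef_fromBlocks_diag, zero_smul, sub_zero]
    refine ⟨(hX i).E_pos, (hX i).EN_pos, (hX i).Φ_pos, (hX i).perf, hκ i, ?_, ?_⟩
    · have e : (X i).S - κ • 1 - ((X i).F - (2 * κ) • 1) = ((X i).S - (X i).F) + κ • 1 := by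
        module
      change ((X i).S - κ • 1 - ((X i).F - (2 * κ) • 1)).PosDef
      rw [e]
      exact PosDef.posSemidef_add (hX i).F_le_S (PosDef.one.smul hκ0)
    · have e : (loc (G κ) i).S = (1 : ℝ) • (loc X i).S + (-κ) • (fun _ => 1 :
          ∀ j : {j // j ∈ d.nbhd i}, Matrix (d.NIdx j.1) (d.NIdx j.1) ℝ) := by

        funext j
        change (X j.1).S - κ • 1 = (1 : ℝ) • (X j.1).S + (-κ) • 1
        module
      rw [e, Network.coupling_combo, one_smul, neg_smul, ← sub_eq_add_neg, neg_sub, sub_eq_neg_add]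
      exact PosDef.posSemidef_add (hX i).coupling ((Network.coupling_one_posDef _).smul hκ0)
  · have h1 : (X j.1).S.IsSymm := ((hX i).S_block j).1
    exact h1.sub (isSymm_one.smul κ)
  · have h1 : (X j.1).S k l = 0 := ((hX i).S_block j).2 k l hkl
    have h2 : k ≠ l := fun h => hkl (congrArg Sigma.fst h)
    change (X j.1).S k l - κ * (1 : Matrix (d.NIdx j.1) (d.NIdx j.1) ℝ) k l = 0
    simp [h1, h2]

lemma IsSlater.isSymmVars {ε : ℝ} (hε : 0 ≤ ε) {X : d.GlobalVars} (h : IsSlater ε X) (i : Fin M) :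
    IsSymmVars (loc X i) :=
  isSymmVars_of_strictLMI (h.strict hε i)

lemma IsSlater.eventually {X : d.GlobalVars} (h : IsSlater 0 X) : ∀ᶠ ε in 𝓝 (0 : ℝ),
    IsSlater ε X := by
  refine eventually_all.2 fun i => ?_
  have h1 : ∀ᶠ ε in 𝓝 (0 : ℝ), (lmi ε (loc X i)).PosDef :=
    eventually_posDef (f := fun ε => lmi ε (loc X i))
      (continuous_lmi.comp (continuous_id.prodMk continuous_const))
      (fun ε => lmi_isHermitian ε (h.isSymmVars le_rfl i)) (h i).1
  obtain ⟨a, b, hab⟩ := d.exists_multCom_eq i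
  have h2 := (h i).2.1
  rw [hab] at h2
  obtain ⟨τ, l, hτ, hl, hP⟩ := h2
  filter_upwards [h1, gt_mem_nhds hτ] with ε h3 h4
  exact ⟨h3, by rw [hab]; exact ⟨τ, l, h4, hl, hP⟩, (h i).2.2⟩

lemma cost_nonneg_of_strictFeasible {X : d.GlobalVars} (hX : X ∈ d.strictFeasible) :
    0 ≤ d.cost X :=
  Finset.sum_nonneg fun i _ => (hX i).Φ_pos.posSemidef.trace_nonneg

lemma bddBelow_cost_strictFeasible : BddBelow (d.cost '' d.strictFeasible) :=
  ⟨0, by rintro _ ⟨X, hX, rfl⟩; exact cost_nonneg_of_strictFeasible hX⟩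

/-- For ε = 0 a feasible point need not be strictly feasible, but nearby points of the segment
towards a Slater point are, and their costs converge to its cost. -/
lemma sInf_le_cost_of_feasible {ε : ℝ} (hε : 0 ≤ ε) {X X' : d.GlobalVars} (h : X ∈ d.feasible ε)
    (h' : IsSlater ε X') : sInf (d.cost '' d.strictFeasible) ≤ d.cost X := by
  have hl : Tendsto (fun s : ℝ => (1 - s) * d.cost X + s * d.cost X') (𝓝[>] 0)
      (𝓝 ((1 - 0) * d.cost X + 0 * d.cost X')) :=
    Tendsto.mono_left (Continuous.tendsto (by fun_prop) 0) nhdsWithin_le_nhds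
  rw [sub_zero, one_mul, zero_mul, add_zero] at hl
  refine ge_of_tendsto hl ?_
  filter_upwards [Ioo_mem_nhdsGT (zero_lt_one' ℝ)] with s hs
  rw [← cost_combo]
  exact csInf_le bddBelow_cost_strictFeasible ⟨_, (IsSlater.combo h h'
    (by linarith [hs.2] : 0 ≤ 1 - s) hs.1 (by ring)).strict hε, rfl⟩

/-! ### Local copies -/

/-- The copies held by agent `i` that enter its matrix inequalities. -/
def copyLoc (Ξ : d.AgentVars i) : d.LocVars i :=
  (Ξ.Φ, fun j => Ξ.E ⟨j.1, d.nbhd_subset_cnbhd i j.2⟩, Ξ.P,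
    fun j => Ξ.S ⟨j.1, d.nbhd_subset_cnbhd i j.2⟩, Ξ.F, Ξ.Y)

lemma continuous_copyLoc : Continuous (copyLoc : d.AgentVars i → d.LocVars i) := by
  unfold copyLoc
  fun_prop

lemma mem_localSet_iff {ε : ℝ} {Ξ : d.AgentVars i} :
    Ξ ∈ d.localSet ε i ↔ ((lmi ε (copyLoc Ξ)).PosSemidef ∧ Ξ.P ∈ d.multCom i (Set.Ici ε) ∧
      SBlock (copyLoc Ξ)) ∧
      ∀ j, (Ξ.E j - ε • 1).PosSemidef ∧ (Ξ.S j).IsSymm ∧ d.IsBlockDiag j.1 (Ξ.S j) :=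
  and_congr (marginLMI_iff (copyLoc Ξ)) Iff.rfl

lemma convex_localSet (ε : ℝ) (i : Fin M) : Convex ℝ (d.localSet ε i) := by
  intro Ξ h Ξ' h' a b ha hb hab
  rw [mem_localSet_iff] at *
  refine ⟨⟨?_, convex_multCom (convex_Ici ε) h.1.2.1 h'.1.2.1 ha hb hab,
    h.1.2.2.combo h'.1.2.2 a b⟩, fun j => ⟨?_, ?_, fun k l hkl => ?_⟩⟩
  · have := lmi_combo hab ε ε (copyLoc Ξ) (copyLoc Ξ')
    rw [← add_mul, hab, one_mul] at this
    have e : copyLoc (a • Ξ + b • Ξ') = a • copyLoc Ξ + b • copyLoc Ξ' := rfl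
    rw [e, this]
    exact (h.1.1.smul ha).add (h'.1.1.smul hb)
  · have := ((h.2 j).1.smul ha).add ((h'.2 j).1.smul hb)
    convert this using 1
    change a • Ξ.E j + b • Ξ'.E j - ε • 1 = _
    have e : ε = (a + b) * ε := by rw [hab, one_mul]
    nth_rewrite 1 [e]
    module
  · exact ((h.2 j).2.1.smul a).add ((h'.2 j).2.1.smul b)
  · change a * Ξ.S j k l + b * Ξ'.S j k l = 0
    rw [(h.2 j).2.2 k l hkl, (h'.2 j).2.2 k l hkl]
    simp

lemma isClosed_isSymm_and_isBlockDiag (j : Fin M) :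
    IsClosed {S : Matrix (d.NIdx j) (d.NIdx j) ℝ | S.IsSymm ∧ d.IsBlockDiag j S} := by
  refine IsClosed.inter (isClosed_eq continuous_id.matrix_transpose continuous_id) ?_
  have : {S : Matrix (d.NIdx j) (d.NIdx j) ℝ | d.IsBlockDiag j S} =
      ⋂ a, ⋂ b, ⋂ _ : a.1 ≠ b.1, {S | S a b = 0} := by
    ext S; simp [Network.IsBlockDiag]
  change IsClosed {S : Matrix (d.NIdx j) (d.NIdx j) ℝ | d.IsBlockDiag j S}
  rw [this]
  exact isClosed_iInter fun a => isClosed_iInter fun b => isClosed_iInter fun _ =>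
    isClosed_eq (continuous_id.matrix_elem a b) continuous_const

lemma isClosed_localSet (ε : ℝ) (i : Fin M) : IsClosed (d.localSet ε i) := by
  have : d.localSet ε i = (({Ξ | (lmi ε (copyLoc Ξ)).PosSemidef} ∩
      {Ξ | Ξ.P ∈ d.multCom i (Set.Ici ε)}) ∩ {Ξ | SBlock (copyLoc Ξ)}) ∩
      ⋂ j, ({Ξ | (Ξ.E j - ε • 1).PosSemidef} ∩
        {Ξ | (Ξ.S j).IsSymm ∧ d.IsBlockDiag j.1 (Ξ.S j)}) := by
    ext Ξ
    rw [mem_localSet_iff]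
    simp only [Set.mem_inter_iff, Set.mem_ofPred_eq, Set.mem_iInter, and_assoc]
  rw [this]
  have hE : ∀ j, Continuous fun Ξ : d.AgentVars i => Ξ.E j := fun j => by fun_prop
  have hS : ∀ j, Continuous fun Ξ : d.AgentVars i => Ξ.S j := fun j => by fun_prop
  have hP : Continuous fun Ξ : d.AgentVars i => Ξ.P := by fun_prop
  refine IsClosed.inter (IsClosed.inter (IsClosed.inter ?_ ((isClosed_multCom ε).preimage hP)) ?_)
    (isClosed_iInter fun j => IsClosed.inter ?_ ?_)
  · exact isClosed_posSemidef.preimage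
      (continuous_lmi.comp (continuous_const.prodMk continuous_copyLoc))
  · have : {Ξ : d.AgentVars i | SBlock (copyLoc Ξ)} =
        ⋂ j, {Ξ | ((copyLoc Ξ).S j).IsSymm ∧ d.IsBlockDiag j.1 ((copyLoc Ξ).S j)} := by
      ext Ξ; simp [SBlock]
    rw [this]
    exact isClosed_iInter fun j => (isClosed_isSymm_and_isBlockDiag (d := d) j.1).preimage
      (hS ⟨j.1, d.nbhd_subset_cnbhd i j.2⟩)
  · exact isClosed_posSemidef.preimage ((hE j).sub continuous_const)
  · exact (isClosed_isSymm_and_isBlockDiag j.1).preimage (hS j)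

/-- The variables of all agents. -/
abbrev AllVars (d : GrayBox M N) : Type := ∀ i, d.AgentVars i

/-- The product of the constraint sets of the agents. -/
def prodSet (d : GrayBox M N) (ε : ℝ) : Set d.AllVars := {Ξ | ∀ i, Ξ i ∈ d.localSet ε i}

lemma convex_prodSet (ε : ℝ) : Convex ℝ (d.prodSet ε) :=
  fun _ h _ h' _ _ ha hb hab i => convex_localSet ε i (h i) (h' i) ha hb hab

lemma isClosed_prodSet (ε : ℝ) : IsClosed (d.prodSet ε) := by
  have : d.prodSet ε = ⋂ i, (fun Ξ : d.AllVars => Ξ i) ⁻¹' d.localSet ε i := by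
    ext; simp [prodSet]
  exact this ▸ isClosed_iInter fun i => (isClosed_localSet ε i).preimage (continuous_apply i)

/-- Consistent copies of the variables of the global problem. -/
def lift (X : d.GlobalVars) : d.AllVars := fun i =>
  ((X i).Φ, fun j => (X j.1).E, (X i).P, fun j => (X j.1).S, (X i).F, (X i).Y)

/-- The owners' variables. -/
def owners (Ξ : d.AllVars) : d.GlobalVars := fun i => (Ξ i).own


lemma continuous_owners : Continuous (owners : d.AllVars → d.GlobalVars) := by
  unfold owners AgentVars.own
  fun_prop

lemma lift_mem_prodSet {ε : ℝ} {X : d.GlobalVars} (hX : X ∈ d.feasible ε) :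
    lift X ∈ d.prodSet ε := fun i =>
  ⟨hX i, fun j => ⟨(hX j.1).E_pos, (hX j.1).S_block ⟨j.1, d.self_mem_nbhd j.1⟩⟩⟩

/-- All copies agree with the owners' variables. -/
def Consistent (Ξ : d.AllVars) : Prop :=
  ∀ j (i : {i // i ∈ d.cnbhd j}), (Ξ j).E i = (Ξ i.1).own.E ∧ (Ξ j).S i = (Ξ i.1).own.S

lemma Consistent.owners_mem {ε : ℝ} {Ξ : d.AllVars} (h : Consistent Ξ) (hΞ : Ξ ∈ d.prodSet ε) :
    owners Ξ ∈ d.feasible ε := by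
  rw [mem_feasible_iff]
  intro i
  have h1 := (mem_localSet_iff.1 (hΞ i)).1
  have e : loc (owners Ξ) i = copyLoc (Ξ i) := by
    simp only [loc, copyLoc, Prod.mk.injEq]
    exact ⟨rfl, funext fun j => (h i ⟨j.1, d.nbhd_subset_cnbhd i j.2⟩).1.symm, rfl,
      funext fun j => (h i ⟨j.1, d.nbhd_subset_cnbhd i j.2⟩).2.symm, rfl, rfl⟩

  rw [e]
  exact h1

end GrayBox

lemma eq_zero_of_ray_subset_compact {E : Type*} [AddCommGroup E] [Module ℝ E] [TopologicalSpace E]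
    [IsTopologicalAddGroup E] [ContinuousSMul ℝ E] [T2Space E] [FiniteDimensional ℝ E]
    {K : Set E} (hK : IsCompact K) {x w : E} (h : ∀ n : ℕ, x + (n : ℝ) • w ∈ K) : w = 0 := by
  obtain ⟨C, hC⟩ := (hK.image (toEuclidean (E := E)).continuous).isBounded.exists_norm_le
  by_contra hw
  have hpos : 0 < ‖toEuclidean w‖ := by simpa using hw
  obtain ⟨n, hn⟩ := exists_nat_gt ((C + ‖toEuclidean x‖) / ‖toEuclidean w‖)
  rw [div_lt_iff₀ hpos] at hn
  have h1 := hC _ ⟨_, h n, rfl⟩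
  rw [map_add, map_smul] at h1
  have h2 := norm_sub_norm_le ((n : ℝ) • toEuclidean w) (-toEuclidean x)
  rw [norm_neg, sub_neg_eq_add, add_comm (_ • _), norm_smul, Real.norm_natCast] at h2
  linarith

/-! ### Reduction of the iteration to the abstract method of multipliers -/

namespace GrayBox

variable {M N : ℕ} {d : GrayBox M N} {i : Fin M}

/-- The space of the copies `h_e(Ξ_i)`, over all edges at agent `i`. -/
abbrev AgentSpace (d : GrayBox M N) (i : Fin M) : Type :=
  PiLp 2 fun e : d.Inc i => d.EdgeVec e.1

/-- The space of the copies `h_e(Ξ_i)`, over all agents `i` and all edges at `i`. -/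
abbrev CopySpace (d : GrayBox M N) : Type :=
  PiLp 2 fun k : Σ i, d.Inc i => d.EdgeVec k.2.1

/-- `h_e` as a linear map. -/
def hLin (e : d.Inc i) : d.AgentVars i →ₗ[ℝ] d.EdgeVec e.1 where
  toFun Ξ := Ξ.h e
  map_add' Ξ Ξ' := by ext ⟨q, ab | ab⟩ <;> rfl
  map_smul' r Ξ := by ext ⟨q, ab | ab⟩ <;> rfl

/-- The copies `h_e(Ξ_i)`, over all edges at agent `i`, as a linear map. -/
def agentCopies (d : GrayBox M N) (i : Fin M) : d.AgentVars i →ₗ[ℝ] d.AgentSpace i where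
  toFun Ξ := WithLp.toLp 2 fun e => Ξ.h e
  map_add' Ξ Ξ' := by ext1 e; exact (hLin e).map_add Ξ Ξ'
  map_smul' r Ξ := by ext1 e; exact (hLin e).map_smul r Ξ

/-- The copies `h_e(Ξ_i)`, over all agents and edges, as a linear map. -/
def copies (d : GrayBox M N) : d.AllVars →ₗ[ℝ] d.CopySpace where
  toFun Ξ := WithLp.toLp 2 fun k => (Ξ k.1).h k.2
  map_add' Ξ Ξ' := by ext1 k; exact (hLin k.2).map_add (Ξ k.1) (Ξ' k.1)
  map_smul' r Ξ := by ext1 k; exact (hLin k.2).map_smul r (Ξ k.1)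

/-- `trace(Φ_i)` as a linear map. -/
def agentCost (d : GrayBox M N) (i : Fin M) : d.AgentVars i →ₗ[ℝ] ℝ where
  toFun Ξ := Ξ.Φ.trace
  map_add' Ξ Ξ' := trace_add Ξ.Φ Ξ'.Φ
  map_smul' r Ξ := trace_smul r Ξ.Φ

/-- The objective `∑_i trace(Φ_i)` as a linear map on the variables of all agents. -/
def totalCost (d : GrayBox M N) : d.AllVars →ₗ[ℝ] ℝ where
  toFun Ξ := d.cost (owners Ξ)
  map_add' Ξ Ξ' := by
    simp only [cost, ← Finset.sum_add_distrib]
    exact Finset.sum_congr rfl fun i _ => trace_add (Ξ i).Φ (Ξ' i).Φ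
  map_smul' r Ξ := by
    simp only [cost, RingHom.id_apply, smul_eq_mul, Finset.mul_sum]
    exact Finset.sum_congr rfl fun i _ => trace_smul r (Ξ i).Φ

/-- Copies that are equal to given edge variables. -/
def broadcast (d : GrayBox M N) : d.EdgeVars →ₗ[ℝ] d.CopySpace where
  toFun ν := WithLp.toLp 2 fun k => ν k.2.1
  map_add' _ _ := rfl
  map_smul' _ _ := rfl

/-- The subspace of the copies on which the agents agree. -/
def consensus (d : GrayBox M N) : Submodule ℝ d.CopySpace := LinearMap.range d.broadcast

/-- The dual variables as one vector. -/
def dualVec (μ : d.DualVars) : d.CopySpace := WithLp.toLp 2 fun k => μ k.1 k.2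

lemma inner_copySpace (x y : d.CopySpace) :
    inner ℝ x y = ∑ i, ∑ e : d.Inc i, inner ℝ (x ⟨i, e⟩) (y ⟨i, e⟩) := by
  rw [PiLp.inner_apply, Fintype.sum_sigma]

/-- The sum over agents and their edges is regrouped by edges, where the consensus vector has the
same entry at both ends. -/
lemma dualVec_mem_orthogonal {μ : d.DualVars}
    (h : ∀ e : d.Edge, ∑ q : d.Endpt e, (μ q.1 ⟨e, q.2⟩ : d.EdgeVec e) = 0) : dualVec μ ∈ d.consensusᗮ := by
  rw [Submodule.mem_orthogonal]
  rintro _ ⟨ν, rfl⟩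
  let _ : Fintype d.Edge := Fintype.ofFinite _
  let φ : (Σ i, d.Inc i) ≃ Σ e : d.Edge, d.Endpt e :=
    { toFun := fun k => ⟨k.2.1, ⟨k.1, k.2.2⟩⟩
      invFun := fun k => ⟨k.2.1, ⟨k.1, k.2.2⟩⟩
      left_inv := fun _ => rfl
      right_inv := fun _ => rfl }
  rw [PiLp.inner_apply, ← φ.symm.sum_comp, Fintype.sum_sigma]
  refine Finset.sum_eq_zero fun e _ => ?_
  change ∑ q : d.Endpt e, inner ℝ (ν e) (μ q.1 ⟨e, q.2⟩) = 0
  rw [← inner_sum, h e, inner_zero_right]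


lemma copies_lift_mem (X : d.GlobalVars) : d.copies (lift X) ∈ d.consensus :=
  ⟨d.edgeVec X, rfl⟩

/-- An agent that holds copies of another shares an edge with it, and the edge vector contains E and
S of both ends. -/
lemma consistent_of_copies_mem {Ξ : d.AllVars} (h : d.copies Ξ ∈ d.consensus) : Consistent Ξ := by
  obtain ⟨ν, hν⟩ := h
  have h1 : ∀ j (e : d.Inc j), ν e.1 = (Ξ j).h e := fun j e =>
    congrArg (fun x : d.CopySpace => x ⟨j, e⟩) hν
  rintro j ⟨i, hi⟩
  by_cases hij : i = j
  · subst hij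
    exact ⟨rfl, rfl⟩
  · have hadj : d.comm.Adj j i := by
      simp only [Network.cnbhd, Finset.mem_filter, Finset.mem_univ, true_and] at hi
      exact hi.resolve_right hij
    let e : d.Edge := ⟨s(j, i), hadj⟩
    have h2 : (Ξ j).h ⟨e, Sym2.mem_mk_left j i⟩ = (Ξ i).h ⟨e, Sym2.mem_mk_right j i⟩ :=
      (h1 j ⟨e, Sym2.mem_mk_left j i⟩).symm.trans (h1 i ⟨e, Sym2.mem_mk_right j i⟩)
    constructor
    · ext a b
      exact congrArg (fun x : d.EdgeVec e =>
        x ⟨(⟨i, Sym2.mem_mk_right j i⟩ : {q // q ∈ e.1}), Sum.inl (a, b)⟩) h2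
    · ext a b
      exact congrArg (fun x : d.EdgeVec e =>
        x ⟨(⟨i, Sym2.mem_mk_right j i⟩ : {q // q ∈ e.1}), Sum.inr (a, b)⟩) h2

lemma cost_le_of_mem_solutions {ε : ℝ} {X : d.GlobalVars} (hX : X ∈ d.solutions ε)
    {Ξ : d.AllVars} (hΞ : Ξ ∈ d.prodSet ε) (h : d.copies Ξ ∈ d.consensus) :
    d.cost X ≤ d.totalCost Ξ :=
  hX.2 ((consistent_of_copies_mem h).owners_mem hΞ)

lemma owners_mem_solutions {ε : ℝ} {X : d.GlobalVars} (hX : X ∈ d.solutions ε)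
    {Ξ : d.AllVars} (hΞ : Ξ ∈ d.prodSet ε) (h : d.copies Ξ ∈ d.consensus)
    (hc : d.totalCost Ξ ≤ d.cost X) : owners Ξ ∈ d.solutions ε :=
  ⟨(consistent_of_copies_mem h).owners_mem hΞ, fun _ hY => hc.trans (hX.2 hY)⟩

/-! ### Directions of recession -/

/-- Moving consistent copies of a solution along D preserves consensus and does not raise the cost,
so the owners trace a ray of solutions. Compactness makes the owners' part of D vanish, and
consistency the remaining copies. -/
lemma eq_zero_of_isRecession {ε : ℝ} (hc : IsCompact (d.solutions ε))
    (hne : (d.solutions ε).Nonempty) {D : d.AllVars} (hD : IsRecession (d.prodSet ε) D)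
    (hL : d.copies D = 0) (hf : d.totalCost D ≤ 0) : D = 0 := by
  obtain ⟨X, hX⟩ := hne
  have h1 : owners D = 0 := by
    refine eq_zero_of_ray_subset_compact hc (x := X) fun n => ?_
    refine owners_mem_solutions (Ξ := lift X + (n : ℝ) • D) hX
      (hD _ (lift_mem_prodSet hX.1) n) ?_ ?_
    · rw [map_add, map_smul, hL, smul_zero, add_zero]
      exact copies_lift_mem X
    · rw [map_add, map_smul, smul_eq_mul]
      have : d.totalCost (lift X) = d.cost X := rfl
      have : (n : ℝ) * d.totalCost D ≤ 0 := mul_nonpos_of_nonneg_of_nonpos n.cast_nonneg hf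
      linarith
  have h2 := consistent_of_copies_mem (hL ▸ Submodule.zero_mem _ : d.copies D ∈ d.consensus)
  have h3 : ∀ j, (D j).own = 0 := fun j => congrFun h1 j
  funext j
  have hE : (D j).E = 0 := funext fun k => by
    rw [(h2 j k).1, h3]; rfl
  have hS : (D j).S = 0 := funext fun k => by
    rw [(h2 j k).2, h3]; rfl
  have hΦ : (D j).Φ = 0 := congrArg OwnVars.Φ (h3 j)
  have hP : (D j).P = 0 := congrArg OwnVars.P (h3 j)
  have hF : (D j).F = 0 := congrArg OwnVars.F (h3 j)
  have hY : (D j).Y = 0 := congrArg OwnVars.Y (h3 j)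
  exact Prod.ext hΦ (Prod.ext hE (Prod.ext hP (Prod.ext hS (Prod.ext hF hY))))

/-- Extended by zero, a direction of one agent becomes one of the product set, so global compactness
controls each local minimization. -/
lemma eq_zero_of_isRecession_agent {ε : ℝ} (hc : IsCompact (d.solutions ε))
    (hne : (d.solutions ε).Nonempty) {D : d.AgentVars i} (hD : IsRecession (d.localSet ε i) D)
    (hL : d.agentCopies i D = 0) (hf : d.agentCost i D ≤ 0) : D = 0 := by
  have h1 : ∀ j ≠ i, (Pi.single i D : d.AllVars) j = 0 := fun j hj => Pi.single_eq_of_ne hj D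
  have h0 : (Pi.single i D : d.AllVars) i = D := Pi.single_eq_same i D
  have h2 : (Pi.single i D : d.AllVars) = 0 := by
    refine eq_zero_of_isRecession hc hne (fun y hy n j => ?_) ?_ ?_
    · by_cases hj : j = i
      · subst hj
        rw [Pi.add_apply, Pi.smul_apply, h0]
        exact hD _ (hy j) n
      · rw [Pi.add_apply, Pi.smul_apply, h1 j hj, smul_zero, add_zero]
        exact hy j
    · ext1 ⟨j, e⟩
      change hLin e ((Pi.single i D : d.AllVars) j) = 0
      by_cases hj : j = i
      · subst hj
        rw [h0]
        exact congrArg (fun x : d.AgentSpace j => x e) hL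
      · rw [h1 j hj, map_zero]
    · change ∑ j, d.agentCost j ((Pi.single i D : d.AllVars) j) ≤ 0
      rw [Finset.sum_eq_single i (fun j _ hj => by rw [h1 j hj, map_zero]) (by simp), h0]
      exact hf
  rw [← h0, h2]; rfl

/-! ### Optimality conditions of the updates -/

/-- The edge variables at agent `i`. -/
def edgeVarsAt (ν : d.EdgeVars) (i : Fin M) : d.AgentSpace i := WithLp.toLp 2 fun e => ν e.1

lemma agentObjective_eq (α : ℝ) (i : Fin M) (ν : d.EdgeVars) (μ : d.DualVars) :
    d.agentObjective α i ν μ = fun Ξ => d.agentCost i Ξ +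
      (inner ℝ (WithLp.toLp 2 (μ i) : d.AgentSpace i)
        (d.agentCopies i Ξ - edgeVarsAt ν i) +
        α / 2 * ‖d.agentCopies i Ξ - edgeVarsAt ν i‖ ^ 2) := by
  funext Ξ
  rw [PiLp.inner_apply, PiLp.norm_sq_eq_of_L2, Finset.mul_sum, ← Finset.sum_add_distrib]
  rfl

/-- The dual update turns the agent's gradient μᵗ + α(h - νᵗ) into μᵗ⁺¹ + α(νᵗ⁺¹ - νᵗ). -/
lemma IsRun.variational {ε α : ℝ} {Ξ : ℕ → d.AllVars} {ν : ℕ → d.EdgeVars} {μ : ℕ → d.DualVars}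
    (h : d.IsRun ε α Ξ ν μ) (t : ℕ) {Y : d.AllVars} (hY : Y ∈ d.prodSet ε) :
    0 ≤ d.totalCost Y - d.totalCost (Ξ (t + 1)) +
      inner ℝ (dualVec (μ (t + 1)) + α • (d.broadcast (ν (t + 1)) - d.broadcast (ν t)))
        (d.copies Y - d.copies (Ξ (t + 1))) := by
  have h1 : ∀ i, 0 ≤ d.agentCost i (Y i) - d.agentCost i (Ξ (t + 1) i) +
      ∑ e : d.Inc i, inner ℝ (μ (t + 1) i e + α • (ν (t + 1) e.1 - ν t e.1))
        ((Y i).h e - (Ξ (t + 1) i).h e) := by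
    intro i
    have hmin := h.agent_min t i
    rw [agentObjective_eq] at hmin
    have := variational_of_isMinOn_augmented (convex_localSet ε i) _ _ _ _ (h.agent_mem t i) hmin
      (Y i) (hY i)
    rw [PiLp.inner_apply] at this
    refine this.trans_eq (congrArg _ (Finset.sum_congr rfl fun e _ => ?_))
    change inner ℝ (μ t i e + α • ((Ξ (t + 1) i).h e - ν t e.1)) ((Y i).h e - (Ξ (t + 1) i).h e) = _
    rw [h.dual t i e]
    congr 1
    module
  have h2 := Finset.sum_nonneg fun i (_ : i ∈ Finset.univ) => h1 i
  rw [Finset.sum_add_distrib, Finset.sum_sub_distrib] at h2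
  rw [inner_copySpace]
  exact h2

/-- The dual variables at the edge `e`. -/
def dualAt (μ : d.DualVars) (e : d.Edge) (q : d.Endpt e) : d.EdgeVec e := μ q.1 ⟨e, q.2⟩

/-- The copies at the edge `e`. -/
def copiesAt (Ξ : d.AllVars) (e : d.Edge) (q : d.Endpt e) : d.EdgeVec e := (Ξ q.1).h ⟨e, q.2⟩

lemma edgeObjective_eq (α : ℝ) (e : d.Edge) (Ξ : d.AllVars) (μ : d.DualVars) :
    d.edgeObjective α e Ξ μ = fun y => ∑ q, (inner ℝ (dualAt μ e q) (copiesAt Ξ e q - y) +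
      α / 2 * ‖copiesAt Ξ e q - y‖ ^ 2) := rfl

lemma IsRun.sum_dual {ε α : ℝ} {Ξ : ℕ → d.AllVars} {ν : ℕ → d.EdgeVars} {μ : ℕ → d.DualVars}
    (h : d.IsRun ε α Ξ ν μ) (t : ℕ) (e : d.Edge) :
    ∑ q, dualAt (μ (t + 1)) e q = 0 := by
  have h0 := h.edge_min t e
  rw [edgeObjective_eq] at h0
  rw [← sum_eq_zero_of_isMinOn_augmented _ _ _ _ h0]
  exact Finset.sum_congr rfl fun q _ => h.dual t q.1 ⟨e, q.2⟩



/-- The shift by one is needed because the arbitrary initial μ may fail to be orthogonal to the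
consensus subspace. -/
lemma IsRun.isSplittingRun {ε α : ℝ} {Ξ : ℕ → d.AllVars} {ν : ℕ → d.EdgeVars}
    {μ : ℕ → d.DualVars} (h : d.IsRun ε α Ξ ν μ) :
    IsSplittingRun ((fun Y => (d.totalCost Y, d.copies Y)) '' d.prodSet ε) d.consensus α
      (fun t => d.totalCost (Ξ (t + 1))) (fun t => d.copies (Ξ (t + 1)))
      (fun t => d.broadcast (ν (t + 1))) (fun t => dualVec (μ (t + 1))) where
  ν_mem t := ⟨_, rfl⟩
  μ_mem t := dualVec_mem_orthogonal (h.sum_dual t)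
  mem t := ⟨_, h.agent_mem (t + 1), rfl⟩
  dual t := by
    ext1 ⟨i, e⟩
    exact h.dual (t + 1) i e
  var t := by
    rintro _ ⟨Y, hY, rfl⟩
    exact h.variational (t + 1) hY

/-! ### Saddle points -/

/-- The linear side constraints on the copies. -/
def symmSubmodule (d : GrayBox M N) : Submodule ℝ d.AllVars where
  carrier := {v | ∀ i j, ((v i).E j).IsSymm ∧ ((v i).S j).IsSymm ∧
    d.IsBlockDiag j.1 ((v i).S j)}
  zero_mem' i j := ⟨isSymm_zero, isSymm_zero, fun _ _ _ => rfl⟩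
  add_mem' {v v'} h h' i j := ⟨(h i j).1.add (h' i j).1, (h i j).2.1.add (h' i j).2.1,
    fun a b hab => by
      change (v i).S j a b + (v' i).S j a b = 0
      rw [(h i j).2.2 a b hab, (h' i j).2.2 a b hab, add_zero]⟩
  smul_mem' r v h i j := ⟨(h i j).1.smul r, (h i j).2.1.smul r, fun a b hab => by
      change r * (v i).S j a b = 0
      rw [(h i j).2.2 a b hab, mul_zero]⟩

lemma prodSet_subset_symmSubmodule {ε : ℝ} {Ξ : d.AllVars} (h : Ξ ∈ d.prodSet ε) :
    Ξ ∈ d.symmSubmodule := fun i j => by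
  obtain ⟨h1, h2, h3⟩ := (h i).2 j
  refine ⟨?_, h2, h3⟩
  have h4 : ((Ξ i).E j - ε • 1 + ε • 1).IsSymm :=
    IsSymm.add (by simpa [IsHermitian, IsSymm] using h1.1) (isSymm_one.smul ε)
  rwa [sub_add_cancel] at h4

/-- Move the consistent copies of `X` in the direction `v`. -/
def perturb (X : d.GlobalVars) (v : d.AllVars) : d.AllVars := fun i =>
  ((X i).Φ, fun j => (X j.1).E + (v i).E j, (X i).P, fun j => (X j.1).S + (v i).S j, (X i).F,
    (X i).Y)

lemma copies_perturb (X : d.GlobalVars) (v : d.AllVars) :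
    d.copies (perturb X v) = d.copies (lift X) + d.copies v := by
  ext1 ⟨i, e⟩
  ext ⟨q, ab | ab⟩ <;> rfl

/-- P stays fixed, so the possibly empty interior of its cone does no harm; the positive definite
conditions are open among symmetric copies. -/
lemma IsSlater.eventually_perturb {ε : ℝ} (hε : 0 ≤ ε) {X : d.GlobalVars} (h : IsSlater ε X) :
    ∀ᶠ v in 𝓝 (0 : d.symmSubmodule), perturb X v.1 ∈ d.prodSet ε := by
  have hsym := fun i => h.isSymmVars hε i
  have hcE : ∀ i (j : {j // j ∈ d.cnbhd i}),
      Continuous fun v : d.symmSubmodule => (X j.1).E + (v.1 i).E j := fun i j => by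
    have h0 : Continuous fun Ξ : d.AgentVars i => Ξ.E j := by fun_prop
    exact continuous_const.add (h0.comp ((continuous_apply i).comp continuous_subtype_val))
  have hcS : ∀ i (j : {j // j ∈ d.cnbhd i}),
      Continuous fun v : d.symmSubmodule => (X j.1).S + (v.1 i).S j := fun i j => by
    have h0 : Continuous fun Ξ : d.AgentVars i => Ξ.S j := by fun_prop
    exact continuous_const.add (h0.comp ((continuous_apply i).comp continuous_subtype_val))
  have hXS : ∀ j, (X j).S.IsSymm ∧ d.IsBlockDiag j (X j).S := fun j =>
    (h j).2.2 ⟨j, d.self_mem_nbhd j⟩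
  have hblock : ∀ (v : d.symmSubmodule) i (j : {j // j ∈ d.cnbhd i}),
      ((X j.1).S + (v.1 i).S j).IsSymm ∧ d.IsBlockDiag j.1 ((X j.1).S + (v.1 i).S j) := by
    intro v i j
    refine ⟨(hXS j.1).1.add (v.2 i j).2.1, fun a b hab => ?_⟩
    rw [Matrix.add_apply, (hXS j.1).2 a b hab, (v.2 i j).2.2 a b hab, add_zero]
  have hEs : ∀ (v : d.symmSubmodule) i (j : {j // j ∈ d.cnbhd i}),
      ((X j.1).E + (v.1 i).E j).IsHermitian := fun v i j =>
    ((hsym j.1).E ⟨j.1, d.self_mem_nbhd j.1⟩).add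
      (by simpa [IsHermitian, IsSymm] using (v.2 i j).1)
  have h1 : ∀ᶠ v in 𝓝 (0 : d.symmSubmodule), ∀ i,
      (lmi ε (copyLoc (perturb X v.1 i))).PosDef := by
    refine eventually_all.2 fun i => ?_
    refine eventually_posDef (f := fun v : d.symmSubmodule => lmi ε (copyLoc (perturb X v.1 i)))
      ?_ (fun v => ?_) ?_
    · refine continuous_lmi.comp (continuous_const.prodMk ?_)
      refine continuous_copyLoc.comp ?_
      exact continuous_const.prodMk ((continuous_pi fun j => hcE i j).prodMk
        (continuous_const.prodMk ((continuous_pi fun j => hcS i j).prodMk continuous_const)))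
    · refine lmi_isHermitian ε ⟨(hsym i).Φ, fun j => hEs v i _, (hsym i).P, fun j => ?_, (hsym i).F⟩
      have := (hblock v i ⟨j.1, d.nbhd_subset_cnbhd i j.2⟩).1
      exact (by simpa [IsHermitian, IsSymm] using this :
        ((X j.1).S + (v.1 i).S ⟨j.1, d.nbhd_subset_cnbhd i j.2⟩).IsHermitian)
    · have e : copyLoc (perturb X (0 : d.symmSubmodule).1 i) = loc X i := by
        have e1 : (copyLoc (perturb X (0 : d.symmSubmodule).1 i)).E = (loc X i).E :=
          funext fun j => add_zero (X j.1).E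
        have e2 : (copyLoc (perturb X (0 : d.symmSubmodule).1 i)).S = (loc X i).S :=
          funext fun j => add_zero (X j.1).S
        exact Prod.ext rfl (Prod.ext e1 (Prod.ext rfl (Prod.ext e2 rfl)))

      rw [e]
      exact (h i).1
  have h2 : ∀ᶠ v in 𝓝 (0 : d.symmSubmodule), ∀ i (j : {j // j ∈ d.cnbhd i}),
      ((X j.1).E + (v.1 i).E j - ε • 1).PosDef := by
    refine eventually_all.2 fun i => eventually_all.2 fun j => ?_
    refine eventually_posDef
      (f := fun v : d.symmSubmodule => (X j.1).E + (v.1 i).E j - ε • 1)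
      ((hcE i j).sub continuous_const) (fun v => (hEs v i j).sub (by simp [IsHermitian])) ?_
    have h3 := (h j.1).1
    simp only [lmi, posDef_fromBlocks_diag] at h3
    have h4 : ((X j.1).E - ε • 1).PosDef := h3.1
    change ((X j.1).E + 0 - ε • 1).PosDef
    rwa [add_zero]
  filter_upwards [h1, h2] with v h3 h4 i
  exact mem_localSet_iff.2 ⟨⟨(h3 i).posSemidef, multCom_mono Set.Ioi_subset_Ici_self (h i).2.1,
    fun j => hblock v i _⟩, fun j => ⟨(h4 i j).posSemidef, hblock v i j⟩⟩

lemma exists_isSaddle {ε : ℝ} (hε : 0 ≤ ε) {X X' : d.GlobalVars} (hX : X ∈ d.solutions ε)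
    (h' : IsSlater ε X') :
    ∃ m, IsSaddle ((fun Y => (d.totalCost Y, d.copies Y)) '' d.prodSet ε) d.consensus (d.cost X)
      (d.copies (lift X)) m := by
  -- On symmetric, block-diagonal copies the admissible perturbations fill a neighbourhood of zero,
  -- and every feasible point is of this kind.
  obtain ⟨m, hm, hle⟩ := exists_multiplier (V := d.symmSubmodule) (C := {v | v.1 ∈ d.prodSet ε})
    (fun v hv v' hv' a b ha hb hab => convex_prodSet ε hv hv' ha hb hab)
    (d.totalCost ∘ₗ d.symmSubmodule.subtype) (d.copies ∘ₗ d.symmSubmodule.subtype) d.consensus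
    (p := d.cost X) (c₁ := d.cost X')
    (fun v hv hA => cost_le_of_mem_solutions hX hv hA) (by
      filter_upwards [h'.eventually_perturb hε] with v hv
      refine ⟨⟨perturb X' v.1, prodSet_subset_symmSubmodule hv⟩, hv, le_of_eq rfl, ?_⟩
      change d.copies (perturb X' v.1) - d.copies v.1 ∈ _
      rw [copies_perturb, add_sub_cancel_right]
      exact copies_lift_mem X')
  refine ⟨m, subset_closure ⟨_, lift_mem_prodSet hX.1, rfl⟩, copies_lift_mem X, hm, ?_⟩
  rintro _ ⟨Y, hY, rfl⟩
  exact hle ⟨Y, prodSet_subset_symmSubmodule hY⟩ hY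

end GrayBox

/-! ### Cluster points -/

section Cluster

variable {ι X Y : Type*} [TopologicalSpace X] [TopologicalSpace Y] {l : Filter ι} {u : ι → X}
  {x : X}

lemma eq_of_mapClusterPt_of_tendsto [T2Space Y] (h : MapClusterPt x l u) {g : X → Y}
    (hg : Continuous g) {y : Y} (hy : Tendsto (fun t => g (u t)) l (𝓝 y)) : g x = y := by
  have h1 : ClusterPt (g x) (map (g ∘ u) l) := h.continuousAt_comp hg.continuousAt
  have h2 : (𝓝 (g x) ⊓ 𝓝 y).NeBot := h1.mono hy
  exact eq_of_nhds_neBot h2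

lemma mem_of_mapClusterPt_of_isClosed (h : MapClusterPt x l u) {s : Set X} (hs : IsClosed s)
    (hu : ∀ᶠ t in l, u t ∈ s) : x ∈ s := by
  by_contra hx
  exact (h.frequently (hs.isOpen_compl.mem_nhds hx)) (hu.mono fun t ht hn => hn ht)

end Cluster

/-! ### Existence and convergence of runs -/

namespace GrayBox

variable {M N : ℕ} {d : GrayBox M N}

lemma continuous_copies : Continuous d.copies := LinearMap.continuous_of_finiteDimensional _

lemma continuous_totalCost : Continuous d.totalCost := LinearMap.continuous_of_finiteDimensional _

/-- Sublevel sets of the consensus residual and of the cost are compact if the solution set is. -/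
lemma isCompact_sublevel {ε : ℝ} (hc : IsCompact (d.solutions ε))
    (hne : (d.solutions ε).Nonempty) (a b : ℝ) :
    IsCompact {Ξ | Ξ ∈ d.prodSet ε ∧ d.totalCost Ξ ≤ a ∧ ‖d.copies Ξ‖ ≤ b} := by
  refine isCompact_of_no_recession (β := 1) (a := a + b ^ 2) (b := 0) (convex_prodSet ε)
    (isClosed_prodSet ε) (fun _ h => h.1) ?_ d.totalCost d.copies one_pos ?_
    fun D => eq_zero_of_isRecession hc hne
  · exact (isClosed_prodSet ε).inter ((isClosed_le continuous_totalCost continuous_const).inter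
      (isClosed_le continuous_copies.norm continuous_const))
  · rintro Ξ ⟨-, h1, h2⟩
    have := pow_le_pow_left₀ (norm_nonneg _) h2 2
    linarith

lemma exists_agent_update {ε α : ℝ} (hα : 0 < α) (hc : IsCompact (d.solutions ε))
    (hne : (d.solutions ε).Nonempty) (ν : d.EdgeVars) (μ : d.DualVars) :
    ∃ Ξ : d.AllVars, ∀ i, Ξ i ∈ d.localSet ε i ∧
      IsMinOn (d.agentObjective α i ν μ) (d.localSet ε i) (Ξ i) := by
  obtain ⟨X, hX⟩ := hne
  have h : ∀ i, ∃ Ξ ∈ d.localSet ε i,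
      IsMinOn (d.agentObjective α i ν μ) (d.localSet ε i) Ξ := fun i => by
    rw [agentObjective_eq]
    exact exists_isMinOn_augmented (convex_localSet ε i) (isClosed_localSet ε i)
      ⟨_, lift_mem_prodSet hX.1 i⟩ _ _ _ _ hα fun D hD hL hf =>
        eq_zero_of_isRecession_agent hc ⟨X, hX⟩ hD hL hf
  choose Ξ h1 h2 using h
  exact ⟨Ξ, fun i => ⟨h1 i, h2 i⟩⟩

lemma exists_edge_update {α : ℝ} (hα : 0 < α) (Ξ : d.AllVars) (μ : d.DualVars) :
    ∃ ν : d.EdgeVars, ∀ e, IsMinOn (d.edgeObjective α e Ξ μ) Set.univ (ν e) := by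
  have h : ∀ e, ∃ y, IsMinOn (d.edgeObjective α e Ξ μ) Set.univ y := fun e => by
    have : Nonempty (d.Endpt e) := ⟨⟨_, Sym2.out_fst_mem e.1⟩⟩
    rw [edgeObjective_eq]
    exact exists_isMinOn_sum_augmented _ _ hα
  choose ν hν using h
  exact ⟨ν, hν⟩

/-- The iteration is well defined if the solution set is compact. -/
lemma exists_isRun {ε α : ℝ} (hα : 0 < α) (hc : IsCompact (d.solutions ε))
    (hne : (d.solutions ε).Nonempty) (ν₀ : d.EdgeVars) (μ₀ : d.DualVars) :
    ∃ Ξ ν μ, d.IsRun ε α Ξ ν μ ∧ ν 0 = ν₀ ∧ μ 0 = μ₀ := by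
  choose f hf using fun (ν : d.EdgeVars) (μ : d.DualVars) => exists_agent_update hα hc hne ν μ
  choose g hg using fun (Ξ : d.AllVars) (μ : d.DualVars) => exists_edge_update hα Ξ μ
  let step : d.AllVars × d.EdgeVars × d.DualVars → d.AllVars × d.EdgeVars × d.DualVars := fun s =>
    (f s.2.1 s.2.2, g (f s.2.1 s.2.2) s.2.2, fun i e => s.2.2 i e +
      α • ((f s.2.1 s.2.2 i).h e - g (f s.2.1 s.2.2) s.2.2 e.1))
  -- The initial Ξ is immaterial, as no update uses it.
  let seq : ℕ → d.AllVars × d.EdgeVars × d.DualVars := fun t => step^[t] (0, ν₀, μ₀)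
  have hs : ∀ t, seq (t + 1) = step (seq t) := fun t => Function.iterate_succ_apply' step t _
  refine ⟨fun t => (seq t).1, fun t => (seq t).2.1, fun t => (seq t).2.2, ⟨?_, ?_, ?_, ?_⟩, rfl,
    rfl⟩
  · intro t i
    rw [hs]
    exact (hf _ _ i).1
  · intro t i
    rw [hs]
    exact (hf _ _ i).2
  · intro t e
    rw [hs]
    exact hg _ _ e
  · intro t i e
    rw [hs]

lemma Consistent.h_eq {Ξ : d.AllVars} (hΞ : Consistent Ξ) (i : Fin M) (e : d.Inc i) :
    (Ξ i).h e = d.edgeVec (owners Ξ) e.1 := by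
  have hE := fun q : d.Endpt e.1 => (hΞ i ⟨q.1, d.mem_cnbhd_of_endpt e q⟩).1
  have hS := fun q : d.Endpt e.1 => (hΞ i ⟨q.1, d.mem_cnbhd_of_endpt e q⟩).2
  exact congrArg₂ (d.stack e.1) (funext hE) (funext hS)

section Convergence

variable {ε α : ℝ} {Ξ : ℕ → d.AllVars} {ν : ℕ → d.EdgeVars} {μ : ℕ → d.DualVars}
  {X : d.GlobalVars} {νl : d.EdgeVars}

lemma IsRun.tendsto (hε : 0 ≤ ε) (hα : 0 < α) {X' : d.GlobalVars} (hX : X ∈ d.solutions ε)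
    (h' : IsSlater ε X') (h : d.IsRun ε α Ξ ν μ) :
    Tendsto (fun t => d.totalCost (Ξ t)) atTop (𝓝 (d.cost X)) ∧ ∃ νl : d.EdgeVars,
      Tendsto (fun t => d.broadcast (ν t)) atTop (𝓝 (d.broadcast νl)) ∧
      Tendsto (fun t => d.copies (Ξ t)) atTop (𝓝 (d.broadcast νl)) := by
  obtain ⟨m, hm⟩ := exists_isSaddle hε hX h'
  obtain ⟨h1, _, ⟨νl, rfl⟩, h2, h3⟩ := h.isSplittingRun.tendsto hα hm
  exact ⟨(tendsto_add_atTop_iff_nat 1).1 h1, νl, (tendsto_add_atTop_iff_nat 1).1 h2,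
    (tendsto_add_atTop_iff_nat 1).1 h3⟩

lemma IsRun.eventually_mem (h : d.IsRun ε α Ξ ν μ) : ∀ᶠ t in atTop, Ξ t ∈ d.prodSet ε :=
  eventually_atTop.2 ⟨1, fun t ht i => by
    obtain ⟨s, rfl⟩ := Nat.exists_eq_add_of_le' ht
    exact h.agent_mem s i⟩

/-- Closed constraints and continuity of cost and copies suffice; the solution set need not be
compact. -/
lemma IsRun.mapClusterPt (h : d.IsRun ε α Ξ ν μ) (hX : X ∈ d.solutions ε)
    (hcost : Tendsto (fun t => d.totalCost (Ξ t)) atTop (𝓝 (d.cost X)))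
    (hcopies : Tendsto (fun t => d.copies (Ξ t)) atTop (𝓝 (d.broadcast νl)))
    {Ξl : d.AllVars} (hl : MapClusterPt Ξl atTop Ξ) :
    Ξl ∈ d.prodSet ε ∧ d.copies Ξl = d.broadcast νl ∧ Consistent Ξl ∧
      owners Ξl ∈ d.solutions ε := by
  have h1 := mem_of_mapClusterPt_of_isClosed hl (isClosed_prodSet ε) h.eventually_mem
  have h2 : d.copies Ξl = d.broadcast νl :=
    eq_of_mapClusterPt_of_tendsto hl continuous_copies hcopies
  have h3 := eq_of_mapClusterPt_of_tendsto hl continuous_totalCost hcost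
  have h4 : d.copies Ξl ∈ d.consensus := ⟨νl, h2.symm⟩
  exact ⟨h1, h2, consistent_of_copies_mem h4, owners_mem_solutions hX h1 h4 h3.le⟩

lemma IsRun.exists_isCompact (h : d.IsRun ε α Ξ ν μ) (hX : X ∈ d.solutions ε)
    (hcost : Tendsto (fun t => d.totalCost (Ξ t)) atTop (𝓝 (d.cost X)))
    (hcopies : Tendsto (fun t => d.copies (Ξ t)) atTop (𝓝 (d.broadcast νl))) (hc : IsCompact (d.solutions ε)) :
    ∃ K : Set d.AllVars, IsCompact K ∧ ∀ᶠ t in atTop, Ξ t ∈ K := by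
  refine ⟨_, isCompact_sublevel hc ⟨X, hX⟩ (d.cost X + 1) (‖d.broadcast νl‖ + 1), ?_⟩
  filter_upwards [h.eventually_mem, hcost.eventually_le_const (lt_add_one _),
    hcopies.norm.eventually_le_const (lt_add_one _)] with t h1 h2 h3
  exact ⟨h1, h2, h3⟩

/-- A priori the limit of ν is only a limit of feasible copies; compactness provides a cluster point
of Ξ that realizes it. -/
lemma IsRun.exists_solution (h : d.IsRun ε α Ξ ν μ) (hX : X ∈ d.solutions ε)
    (hcost : Tendsto (fun t => d.totalCost (Ξ t)) atTop (𝓝 (d.cost X)))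
    (hcopies : Tendsto (fun t => d.copies (Ξ t)) atTop (𝓝 (d.broadcast νl))) (hc : IsCompact (d.solutions ε)) :
    ∃ Y ∈ d.solutions ε, ∀ e, νl e = d.edgeVec Y e := by
  obtain ⟨K, hK, hev⟩ := h.exists_isCompact hX hcost hcopies hc
  obtain ⟨Ξl, -, hl⟩ := hK.exists_mapClusterPt_of_frequently hev.frequently
  obtain ⟨-, h2, h3, h4⟩ := h.mapClusterPt hX hcost hcopies hl
  refine ⟨_, h4, fun e => ?_⟩
  have h5 := h3.h_eq _ (⟨e, Sym2.out_fst_mem e.1⟩ : d.Inc _)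
  rw [← h5]
  exact (congrArg (fun x : d.CopySpace => x ⟨_, ⟨e, Sym2.out_fst_mem e.1⟩⟩) h2).symm

/-- Leaving an open neighbourhood infinitely often would produce, by compactness, a cluster point
whose owners' part is not a solution. -/
lemma IsRun.tendsto_nhdsSet (h : d.IsRun ε α Ξ ν μ) (hX : X ∈ d.solutions ε)
    (hcost : Tendsto (fun t => d.totalCost (Ξ t)) atTop (𝓝 (d.cost X)))
    (hcopies : Tendsto (fun t => d.copies (Ξ t)) atTop (𝓝 (d.broadcast νl))) (hc : IsCompact (d.solutions ε)) :
    Tendsto (fun t => owners (Ξ t)) atTop (𝓝ˢ (d.solutions ε)) := by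
  obtain ⟨K, hK, hev⟩ := h.exists_isCompact hX hcost hcopies hc
  rw [(hasBasis_nhdsSet _).tendsto_right_iff]
  rintro U ⟨hU, hSU⟩
  by_contra hn
  have hK' : IsCompact (K ∩ owners ⁻¹' Uᶜ) :=
    hK.inter_right (hU.isClosed_compl.preimage continuous_owners)
  have hfr : ∃ᶠ t in atTop, Ξ t ∈ K ∩ owners ⁻¹' Uᶜ :=
    ((not_eventually.1 hn).and_eventually hev).mono fun t ht => ⟨ht.2, ht.1⟩
  obtain ⟨Ξl, hΞl, hl⟩ := hK'.exists_mapClusterPt_of_frequently hfr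
  exact hΞl.2 (hSU (h.mapClusterPt hX hcost hcopies hl).2.2.2)

end Convergence

end GrayBox

end GrayBoxADMM

end

theorem mainTheorem3 {M N : ℕ} (d : GrayBoxADMM.GrayBox M N)
    (hfeas : d.strictFeasible.Nonempty) (η : ℝ) (hη : 0 < η) :
    ∃ ε₀ : ℝ, 0 < ε₀ ∧ ∀ ε : ℝ, 0 ≤ ε → ε < ε₀ → (d.solutions ε).Nonempty →
      ∀ α : ℝ, 0 < α →
      -- the iteration is well defined from every start if the solution set is compact
      (IsCompact (d.solutions ε) → ∀ (ν₀ : d.EdgeVars) (μ₀ : d.DualVars),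
        ∃ Ξ ν μ, d.IsRun ε α Ξ ν μ ∧ ν 0 = ν₀ ∧ μ 0 = μ₀) ∧
      -- convergence of every sequence generated by the iteration
      ∀ (Ξ : ℕ → ∀ i, d.AgentVars i) (ν : ℕ → d.EdgeVars) (μ : ℕ → d.DualVars),
        d.IsRun ε α Ξ ν μ →
        -- the objective converges to the minimum of the global problem
        (∃ c : ℝ, IsLeast (d.cost '' d.feasible ε) c ∧
          Tendsto (fun t => d.cost fun i => (Ξ t i).own) atTop (𝓝 c) ∧
          sInf (d.cost '' d.strictFeasible) ≤ c ∧
          c ≤ sInf (d.cost '' d.strictFeasible) + η) ∧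
        -- the copies held at the two ends of each edge converge to a common limit, which comes from
        -- a solution of the global problem if the solution set is compact
        (∃ νlim : d.EdgeVars,
          (∀ e, Tendsto (fun t => ν t e) atTop (𝓝 (νlim e))) ∧
          (∀ i (e : d.Inc i), Tendsto (fun t => (Ξ t i).h e) atTop (𝓝 (νlim e.1))) ∧
          (IsCompact (d.solutions ε) → ∃ X ∈ d.solutions ε, ∀ e, νlim e = d.edgeVec X e)) ∧
        -- the iterates converge to the solution set if it is compact
        (IsCompact (d.solutions ε) →
          Tendsto (fun t i => (Ξ t i).own) atTop (𝓝ˢ (d.solutions ε))) ∧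
        -- limit points are solutions with consistent copies and satisfy the synthesis inequalities
        (∀ Ξlim : ∀ i, d.AgentVars i, MapClusterPt Ξlim atTop Ξ →
          (∀ j (i : {i // i ∈ d.cnbhd j}),
            (Ξlim j).E i = (Ξlim i.1).own.E ∧ (Ξlim j).S i = (Ξlim i.1).own.S) ∧
          (fun i => (Ξlim i).own) ∈ d.solutions ε ∧
          (0 < ε → ∀ γ : Fin M → ℝ,
            (∀ i, 0 < γ i ∧ (Ξlim i).Φ.trace < γ i ^ 2) →
            d.SynthesisLMIs γ fun i => (Ξlim i).own)) := by
  -- A strictly feasible point of cost below v + η, turned into a Slater point, determines ε₀; it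
  -- gives both the upper bound on the minimum and the multipliers.
  obtain ⟨_, ⟨X₀, hX₀, rfl⟩, hlt⟩ := exists_lt_of_csInf_lt (hfeas.image d.cost)
    (lt_add_of_pos_right (sInf (d.cost '' d.strictFeasible)) hη)
  obtain ⟨X₁, hX₁, hS⟩ := GrayBoxADMM.GrayBox.exists_isSlater hX₀
  obtain ⟨ε₀, hε₀, hball⟩ := Metric.eventually_nhds_iff.1 hS.eventually
  refine ⟨ε₀, hε₀, fun ε hε hlt' ⟨X, hX⟩ α hα => ?_⟩
  have hSε : GrayBoxADMM.GrayBox.IsSlater ε X₁ := hball (by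
    rwa [Real.dist_eq, sub_zero, abs_of_nonneg hε])
  refine ⟨fun hc ν₀ μ₀ => GrayBoxADMM.GrayBox.exists_isRun hα hc ⟨X, hX⟩ ν₀ μ₀,
    fun Ξ ν μ hrun => ?_⟩
  obtain ⟨hcost, νl, hν, hcopies⟩ := hrun.tendsto hε hα hX hSε
  refine ⟨⟨d.cost X, ⟨⟨X, hX.1, rfl⟩, ?_⟩, hcost,
      GrayBoxADMM.GrayBox.sInf_le_cost_of_feasible hε hX.1 hSε, ?_⟩,
    ⟨νl, fun e => ?_, fun i e => ?_, fun hc => hrun.exists_solution hX hcost hcopies hc⟩,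
    fun hc => hrun.tendsto_nhdsSet hX hcost hcopies hc, fun Ξl hl => ?_⟩
  · rintro _ ⟨Y, hY, rfl⟩
    exact hX.2 hY
  · have h1 : d.cost X ≤ d.cost X₁ := hX.2 hSε.feasible
    linarith
  -- The broadcast repeats ν_e at both ends of e, so its limit can be read off at either one.
  · exact (((PiLp.continuous_ofLp 2 _).tendsto _).comp hν).apply_nhds
      (⟨_, ⟨e, Sym2.out_fst_mem e.1⟩⟩ : Σ i, d.Inc i)
  · exact (((PiLp.continuous_ofLp 2 _).tendsto _).comp hcopies).apply_nhds
      (⟨i, e⟩ : Σ i, d.Inc i)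
  · obtain ⟨-, -, h1, h2⟩ := hrun.mapClusterPt hX hcost hcopies hl
    exact ⟨h1, h2, fun hε' γ hγ => ⟨hγ, fun i =>
      GrayBoxADMM.GrayBox.strictLMI_of_margin hε'
        (x := GrayBoxADMM.GrayBox.loc (GrayBoxADMM.GrayBox.owners Ξl) i) (h2.1 i)⟩⟩
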